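/- Let $0<r_{\max}<\pi/4$ and let $S_+=\{\omega\in\mathbb C: 0<\arg\omega<2r_{\max}\}$. Let $\Gamma$ be a complex-valued function such that - $\Gamma$ is meromorphic in the open upper half-plane, with finitely many poles (of any order) in $S_+$; - there are constants $G,\Lambda\in\mathbb R$ and $\nu>0$ with $|\Gamma(\omega)|<G\,e^{-\nu|\mathrm{Re}\,\omega|}$ for all $\omega\in S_+$ with $|\omega|>\Lambda$; - $\Gamma$ is bounded on $S_+\cap\{|\omega|<\delta\}$ for some $\delta>0$, and at every real $x>0$ the function $\Gamma$, restricted to the closed upper half-plane, is continuous. For $\beta\in\mathbb R$ let $n_F(\omega)=1/(e^{\beta\omega}+1)$ and, for $t\ge 0$, $$\Delta^p_+(t)=\int_0^\infty \Gamma(\omega)\,(1-n_F(\omega))\,e^{i\omega t}\,\frac{d\omega}{2\pi},\qquad \Delta^h_+(t)=\int_0^\infty \Gamma(\omega)\,n_F(\omega)\,e^{i\omega t}\,\frac{d\omega}{2\pi}.$$ These integrals converge absolutely. Let $\Delta$ be one of $\Delta^p_+$, $\Delta^h_+$. For all $0<r<r_{\max}$ and $T_0>0$ there are $\varepsilon_0>0$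 and $c>0$, independent of $\beta$, such that for all $\beta\in\mathbb R$, $0<\varepsilon<\varepsilon_0$ and $T\ge T_0$ there are $N\in\mathbb N$ and $\Gamma_k,\omega_k\in\mathbb C$ with $\mathrm{Im}\,\omega_k\ge 0$ such that $$\Delta(t)=\sum_{k=1}^{N}\Gamma_k e^{i\omega_k t}+\delta(t)\quad(0\le t\le T),\qquad \int_0^T|\delta(t)|\,dt<\varepsilon,$$ $$N\le\frac{1}{2\pi r}\,\log\!\Big(\frac{\log(e+T)}{\varepsilon}\Big)\,\log\frac{T}{\varepsilon};$$ and if moreover $\log T\le\varepsilon^{-c}$ (in particular for every fixed $T$ and for $T$ growing polynomially in $1/\varepsilon$, once $\varepsilon$ is small), then such an approximation exists with $$N\le\frac{1}{2\pi r}\,\log\frac1\varepsilon\,\log\frac{T}{\varepsilon}.$$ The same holds for the negative-frequency parts $\Delta^p_-$, $\Delta^h_-$, defined by the same integrals over $(-\infty,0)$, when $\Gamma$ satisfies the same hypotheses with $S_-=\{\pi-2r_{\max}<\arg\omega<\pi\}$ in place of $S_+$ and $x<0$ in place of $x>0$. -/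

import Mathlib

open Complex

/-- The two half-lines of real frequencies, `ω > 0` and `ω < 0`. -/
inductive FreqSign
  | pos
  | neg

/-- The two components of the hybridization function. -/
inductive Species
  | particle
  | hole

/-- The half-line of real frequencies of the given sign. -/
def FreqSign.halfLine : FreqSign → Set ℝ
  | pos => Set.Ioi 0
  | neg => Set.Iio 0

/-- The open sector of opening `θ` in the upper half-plane adjacent to the half-line:
`0 < arg ω < θ` for positive frequencies, and its mirror image
`π - θ < arg ω < π` for negative frequencies. -/
def FreqSign.sector (θ : ℝ) : FreqSign → Set ℂ
  | pos => {ω | 0 < ω.arg ∧ ω.arg < θ}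
  | neg => {ω | Real.pi - θ < ω.arg ∧ ω.arg < Real.pi}

/-- The Fermi-Dirac distribution at inverse temperature `β`. -/
noncomputable def fermi (β : ℝ) (ω : ℂ) : ℂ :=
  1 / (exp (β * ω) + 1)

/-- The occupation factor: `1 - n_F` for particles and `n_F` for holes. -/
noncomputable def Species.occupation (β : ℝ) : Species → ℂ → ℂ
  | particle => fun ω => 1 - fermi β ω
  | hole => fun ω => fermi β ω

/-- The integrand `Γ(ω) (1 - n_F(ω)) e^{iωt} / 2π` (particle) or
`Γ(ω) n_F(ω) e^{iωt} / 2π` (hole). -/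
noncomputable def kernelIntegrand (Γ : ℂ → ℂ) (s : Species) (β t : ℝ) (ω : ℂ) : ℂ :=
  Γ ω * s.occupation β ω * exp (I * ω * t) / (2 * Real.pi)

/-- The part of the particle or hole kernel function that comes from the frequencies
of the given sign. -/
noncomputable def kernel (Γ : ℂ → ℂ) (b : FreqSign) (s : Species) (β t : ℝ) : ℂ :=
  ∫ ω in b.halfLine, kernelIntegrand Γ s β t (ω : ℂ)

/-- The hypotheses on the spectral density, on the side of the frequencies of sign `b`. -/
structure IsAdmissible (Γ : ℂ → ℂ) (b : FreqSign) (rmax : ℝ) : Prop where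
  /-- `Γ` is meromorphic in the open upper half-plane. -/
  meromorphic : MeromorphicOn Γ {ω | 0 < ω.im}
  /-- At least exponential decay at infinity in the sector of opening `2 rmax`. -/
  decay : ∃ G ν Λ : ℝ, 0 < ν ∧ ∀ ω ∈ b.sector (2 * rmax), Λ < ‖ω‖ →
    ‖Γ ω‖ < G * Real.exp (-ν * |ω.re|)
  /-- Finitely many poles in the sector. -/
  finite_poles : {ω | ω ∈ b.sector (2 * rmax) ∧ meromorphicOrderAt Γ ω < 0}.Finite
  /-- The values of `Γ` on the open real half-line are its boundary values from the upper
  half-plane. -/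
  boundary : ∀ x ∈ b.halfLine, ContinuousWithinAt Γ {ω | 0 ≤ ω.im} (x : ℂ)
  /-- `Γ` stays bounded as `ω → 0` in the sector. -/
  bounded_zero : ∃ C δ : ℝ, 0 < δ ∧ ∀ ω ∈ b.sector (2 * rmax), ‖ω‖ < δ → ‖Γ ω‖ ≤ C

/-- `Δ` is on `[0, T]` a sum of `N` non-growing complex exponentials, up to an error `δ` whose
`L¹` norm on `[0, T]` is below `ε`. -/
def ExpApprox (Δ : ℝ → ℂ) (T ε : ℝ) (N : ℕ) : Prop :=
  ∃ (g ω : Fin N → ℂ) (δ : ℝ → ℂ),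
    (∀ k, 0 ≤ (ω k).im) ∧
    (∀ t ∈ Set.Icc 0 T, Δ t = ∑ k, g k * exp (I * ω k * t) + δ t) ∧
    IntervalIntegrable δ MeasureTheory.volume 0 T ∧
    ∫ t in (0 : ℝ)..T, ‖δ t‖ < ε

/-!
In the variable `u = log ω` the integrand decays exponentially at `-∞` and doubly exponentially at
`+∞`, so a trapezoidal rule with step `h` in `u`, along a line `Im u = const` on which `exp (I ω t)`
does not grow, gives a sum of exponentials whose error is governed by the width of the strip of
holomorphy. A pole of `Γ` in the sector would spoil this, but moving the contour across it costs
only finitely many functions `t ^ l * exp (I a t)`, each a limit of sums of exponentials. Rather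
than by residues, they are split off algebraically: write `Γ = A / Q` with a polynomial `Q` clearing
the poles, and `exp (I ω t) = H_t ω + Q ω * R_t ω` with `H_t` the Hermite interpolant at the poles.
The error functional of the quadrature is linear. On `H_t` it is a combination of the functions
`t ^ l * exp (I a t)`, whose number depends on neither `ε` nor `T`. On `Q * R_t` the integrand is
`A * R_t`, which is holomorphic in a strip of half-width any `d < rmax`, and the error is
`O(exp (-2 π d / h) / (1 + t))` up to the truncation of the sum. The factor `1 / (1 + t)` integrates
to `log (1 + T)`, which is the origin of the iterated logarithm, and `r < d` absorbs the lower-order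
terms.
-/

open MeasureTheory Filter Topology FourierTransform ComplexConjugate

/-- `f` is holomorphic in the strip `a < Im z < b`, continuous up to its boundary, and decays
exponentially as `|Re z| → ∞`, uniformly in the closed strip: the class of functions for which
contours may be shifted and trapezoidal sums converge geometrically. -/
structure DecaysInStrip (f : ℂ → ℂ) (a b : ℝ) : Prop where
  diffContOnCl : DiffContOnCl ℂ f (im ⁻¹' Set.Ioo a b)
  exists_bound : ∃ C κ : ℝ, 0 < κ ∧
    ∀ z : ℂ, z.im ∈ Set.Icc a b → ‖f z‖ ≤ C * Real.exp (-κ * |z.re|)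

theorem norm_tsum_int_sub_sum_range_le {E : Type*} [NormedAddCommGroup E] [CompleteSpace E]
    {c : ℤ → E} {A B q : ℝ} {N : ℕ} (hq : 0 ≤ q) (hq' : q < 1)
    (hA : ∀ i : ℕ, ‖c (i + N)‖ ≤ A * q ^ i) (hB : ∀ i : ℕ, ‖c (-(i + 1))‖ ≤ B * q ^ i) :
    Summable c ∧ ‖∑' n, c n - ∑ i ∈ Finset.range N, c i‖ ≤ (A + B) * (1 - q)⁻¹ := by
  have hgeo := hasSum_geometric_of_lt_one hq hq'
  have hright : Summable fun i : ℕ => c i := by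
    rw [← summable_nat_add_iff N]
    exact .of_norm_bounded (hgeo.mul_left A).summable (by simpa using hA)
  have hleft : Summable fun i : ℕ => c (-(i + 1)) :=
    .of_norm_bounded (hgeo.mul_left B).summable hB
  refine ⟨hright.of_nat_of_neg_add_one hleft, ?_⟩
  rw [tsum_of_nat_of_neg_add_one hright hleft, ← hright.sum_add_tsum_nat_add N, add_assoc,
    add_sub_cancel_left, add_mul]
  exact (norm_add_le _ _).trans (add_le_add
    (tsum_of_norm_bounded (hgeo.mul_left A) (by simpa using hA))
    (tsum_of_norm_bounded (hgeo.mul_left B) hB))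

theorem fourier_dilation {E : Type*} [NormedAddCommGroup E] [NormedSpace ℂ E] (f : ℝ → E) {h : ℝ}
    (hh : 0 < h) (w : ℝ) :
    𝓕 (fun x => h • f (x * h)) w = 𝓕 f (w / h) := by
  have hcomp := Measure.integral_comp_mul_right
    (fun x : ℝ => exp (↑(-2 * Real.pi * x * (w / h)) * I) • f x) h
  rw [abs_of_pos (inv_pos.2 hh), eq_comm, inv_smul_eq_iff₀ hh.ne', ← integral_smul] at hcomp
  rw [Real.fourier_real_eq_integral_exp_smul, Real.fourier_real_eq_integral_exp_smul, hcomp]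
  congr 1 with x
  rw [smul_comm]
  congr 5
  field_simp

theorem integrable_exp_neg_mul_abs {κ : ℝ} (hκ : 0 < κ) :
    Integrable fun x : ℝ => Real.exp (-κ * |x|) := by
  rw [← integrableOn_univ, ← Set.Iic_union_Ioi (a := (0 : ℝ))]
  refine IntegrableOn.union ?_ ?_
  · refine (integrableOn_exp_mul_Iic hκ 0).congr_fun (fun x hx => ?_) measurableSet_Iic
    simp [abs_of_nonpos (Set.mem_Iic.1 hx)]
  · refine (exp_neg_integrableOn_Ioi 0 hκ).congr_fun (fun x hx => ?_) measurableSet_Ioi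
    simp [abs_of_pos (Set.mem_Ioi.1 hx)]

namespace DecaysInStrip

variable {f : ℂ → ℂ} {a b : ℝ}

theorem mono {a' b' : ℝ} (hf : DecaysInStrip f a b) (ha : a ≤ a') (hb : b' ≤ b) :
    DecaysInStrip f a' b' :=
  ⟨hf.diffContOnCl.mono (Set.preimage_mono (Set.Ioo_subset_Ioo ha hb)),
    hf.exists_bound.imp fun _ ⟨κ, hκ, h⟩ =>
      ⟨κ, hκ, fun z hz => h z (Set.Icc_subset_Icc ha hb hz)⟩⟩

theorem continuousOn (hf : DecaysInStrip f a b) (hab : a < b) :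
    ContinuousOn f (im ⁻¹' Set.Icc a b) := by
  simpa [closure_preimage_im, closure_Ioo hab.ne] using hf.diffContOnCl.continuousOn

theorem continuous_line (hf : DecaysInStrip f a b) (hab : a < b) {y : ℝ} (hy : y ∈ Set.Icc a b) :
    Continuous fun x : ℝ => f (x + y * I) :=
  (hf.continuousOn hab).comp_continuous (by fun_prop) fun x => by simpa using hy

theorem integrable_line (hf : DecaysInStrip f a b) (hab : a < b) {y : ℝ} (hy : y ∈ Set.Icc a b) :
    Integrable fun x : ℝ => f (x + y * I) := by
  obtain ⟨C, κ, hκ, hC⟩ := hf.exists_bound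
  refine ((integrable_exp_neg_mul_abs hκ).const_mul C).mono'
    (hf.continuous_line hab hy).aestronglyMeasurable (Eventually.of_forall fun x => ?_)
  simpa using hC (x + y * I) (by simpa using hy)

theorem tendsto_intervalIntegral_vertical (hf : DecaysInStrip f a b) {y y' : ℝ}
    (hy : y ∈ Set.Icc a b) (hy' : y' ∈ Set.Icc a b) {s : ℝ → ℝ} (hs : ∀ L, |s L| = |L|) :
    Tendsto (fun L : ℝ => ∫ v : ℝ in y..y', f (s L + v * I)) atTop (𝓝 0) := by
  obtain ⟨C, κ, hκ, hC⟩ := hf.exists_bound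
  have hlim : Tendsto (fun L : ℝ => C * Real.exp (-κ * L) * |y' - y|) atTop (𝓝 0) := by
    have h := Real.tendsto_exp_atBot.comp (tendsto_id.const_mul_atTop_of_neg (neg_neg_of_pos hκ))
    simpa using (h.const_mul C).mul_const |y' - y|
  refine squeeze_zero_norm' ?_ hlim
  filter_upwards [eventually_ge_atTop 0] with L hL
  refine intervalIntegral.norm_integral_le_of_norm_le_const fun v hv => ?_
  have hv' : v ∈ Set.Icc a b := Set.uIcc_subset_Icc hy hy' (Set.uIoc_subset_uIcc hv)
  simpa [hs, abs_of_nonneg hL] using hC (s L + v * I) (by simpa using hv')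

theorem integral_line_eq (hf : DecaysInStrip f a b) (hab : a < b) {y y' : ℝ}
    (hy : y ∈ Set.Icc a b) (hy' : y' ∈ Set.Icc a b) :
    ∫ x : ℝ, f (x + y * I) = ∫ x : ℝ, f (x + y' * I) := by
  have hrect : ∀ L : ℝ, (∫ x : ℝ in (-L)..L, f (x + y * I)) - (∫ x : ℝ in (-L)..L, f (x + y' * I)) +
      I * (∫ v : ℝ in y..y', f (L + v * I)) - I * (∫ v : ℝ in y..y', f (-L + v * I)) = 0 := by
    intro L
    have := integral_boundary_rect_eq_zero_of_continuousOn_of_differentiableOn f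
      (⟨-L, y⟩ : ℂ) ⟨L, y'⟩ ((hf.continuousOn hab).mono fun z hz => ?_)
      (hf.diffContOnCl.differentiableOn.mono fun z hz => ?_)
    · simpa using this
    · exact Set.uIcc_subset_Icc hy hy' hz.2
    · exact ⟨(le_min hy.1 hy'.1).trans_lt hz.2.1, hz.2.2.trans_le (max_le hy.2 hy'.2)⟩
  have hline : ∀ {v : ℝ}, v ∈ Set.Icc a b →
      Tendsto (fun L : ℝ => ∫ x : ℝ in (-L)..L, f (x + v * I)) atTop (𝓝 (∫ x : ℝ, f (x + v * I))) :=
    fun hv => intervalIntegral_tendsto_integral (hf.integrable_line hab hv) tendsto_neg_atTop_atBot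
      tendsto_id
  have hright := (hf.tendsto_intervalIntegral_vertical hy hy' (s := id) (by simp)).const_mul I
  have hleft := (hf.tendsto_intervalIntegral_vertical hy hy' (s := Neg.neg) (by simp)).const_mul I
  have hlim := (((hline hy).sub (hline hy')).add hright).sub hleft
  have := tendsto_nhds_unique (hlim.congr fun L => by simpa using hrect L) tendsto_const_nhds
  simpa [sub_eq_zero] using this

theorem exp_mul (hf : DecaysInStrip f a b) (c y : ℝ) :
    DecaysInStrip (fun z => exp (I * c * (z - y * I)) * f z) a b := by
  obtain ⟨C, κ, hκ, hC⟩ := hf.exists_bound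
  have hexp : Differentiable ℂ fun z : ℂ => exp (I * c * (z - y * I)) := by fun_prop
  refine ⟨hexp.diffContOnCl.smul hf.diffContOnCl, Real.exp (|c| * max |a - y| |b - y|) * C, κ, hκ,
    fun z hz => ?_⟩
  have hre : (I * c * (z - y * I)).re = -(c * (z.im - y)) := by simp
  rw [norm_mul, norm_exp, hre, mul_assoc]
  gcongr
  · refine (neg_le_abs _).trans ((abs_mul _ _).trans_le ?_)
    gcongr
    exact abs_le_max_abs_abs (by linarith [hz.1]) (by linarith [hz.2])
  · exact hC z hz

theorem norm_integral_exp_mul_line_le (hf : DecaysInStrip f a b) (hab : a < b) {y y' : ℝ}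
    (hy : y ∈ Set.Icc a b) (hy' : y' ∈ Set.Icc a b) (c : ℝ) :
    ‖∫ x : ℝ, exp (I * c * x) * f (x + y * I)‖ ≤
      Real.exp (c * (y - y')) * ∫ x : ℝ, ‖f (x + y' * I)‖ := by
  have hshift := (hf.exp_mul c y).integral_line_eq hab hy hy'
  simp only [add_sub_cancel_right] at hshift
  rw [hshift, ← integral_const_mul]
  refine (norm_integral_le_integral_norm _).trans_eq
    (integral_congr_ae (Eventually.of_forall fun x => ?_))
  have hre : (I * c * (x + y' * I - y * I)).re = c * (y - y') := by simp; ring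
  simp only [norm_mul, norm_exp, hre]


theorem norm_fourier_line_le {d B : ℝ} (hf : DecaysInStrip f (a - d) (a + d)) (hd : 0 < d)
    (hB₁ : ∫ x : ℝ, ‖f (x + (a - d : ℝ) * I)‖ ≤ B) (hB₂ : ∫ x : ℝ, ‖f (x + (a + d : ℝ) * I)‖ ≤ B)
    (ξ : ℝ) :
    ‖𝓕 (fun x : ℝ => f (x + a * I)) ξ‖ ≤ B * Real.exp (-2 * Real.pi * d * |ξ|) := by
  have hab : a - d < a + d := by linarith
  have ha : a ∈ Set.Icc (a - d) (a + d) := ⟨by linarith, by linarith⟩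
  have hfourier : 𝓕 (fun x : ℝ => f (x + a * I)) ξ =
      ∫ x : ℝ, exp (I * (-2 * Real.pi * ξ : ℝ) * x) * f (x + a * I) := by
    rw [Real.fourier_real_eq_integral_exp_smul]
    congr 1 with x
    rw [smul_eq_mul]
    congr 2
    push_cast
    ring
  rw [hfourier, mul_comm B]
  rcases le_total 0 ξ with hξ | hξ
  · refine (hf.norm_integral_exp_mul_line_le hab ha (Set.left_mem_Icc.2 hab.le) _).trans ?_
    rw [abs_of_nonneg hξ, sub_sub_cancel, mul_right_comm]
    gcongr
  · refine (hf.norm_integral_exp_mul_line_le hab ha (Set.right_mem_Icc.2 hab.le) _).trans ?_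
    rw [abs_of_nonpos hξ, sub_add_cancel_left, mul_neg, mul_neg, mul_right_comm]
    gcongr

theorem mul_tsum_line_eq_tsum_fourier (hf : DecaysInStrip f a b) (hab : a < b) {y h : ℝ}
    (hy : y ∈ Set.Icc a b) (hh : 0 < h)
    (hs : Summable fun k : ℤ => 𝓕 (fun x : ℝ => f (x + y * I)) (k / h)) :
    h * ∑' n : ℤ, f ((n * h : ℝ) + y * I) =
      ∑' k : ℤ, 𝓕 (fun x : ℝ => f (x + y * I)) (k / h) := by
  obtain ⟨C, κ, hκ, hC⟩ := hf.exists_bound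
  set F : ℝ → ℂ := fun x => h • f ((x * h : ℝ) + y * I) with hF
  have hcont : Continuous F :=
    ((hf.continuous_line hab hy).comp (continuous_id.mul continuous_const)).const_smul h
  have hexp : F =O[cocompact ℝ] fun x : ℝ => Real.exp (-(κ * h) * |x|) := by
    refine Asymptotics.IsBigO.of_bound (h * C) (Eventually.of_forall fun x => ?_)
    have hfx := hC ((x * h : ℝ) + y * I) (by simpa using hy)
    rw [hF, norm_smul, Real.norm_of_nonneg hh.le, mul_assoc,
      Real.norm_of_nonneg (Real.exp_pos _).le]
    gcongr
    refine hfx.trans_eq ?_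
    simp only [add_re, ofReal_re, re_ofReal_mul, I_re, mul_zero, add_zero, abs_mul, abs_of_pos hh]
    ring_nf
  have hdecay : F =O[cocompact ℝ] fun x : ℝ => |x| ^ (-2 : ℝ) :=
    hexp.trans ((isLittleO_exp_neg_mul_rpow_atTop (by positivity) (-2)).comp_tendsto
      (tendsto_norm_cocompact_atTop (E := ℝ))).isBigO
  have hfourier : ∀ k : ℤ, 𝓕 F k = 𝓕 (fun x : ℝ => f (x + y * I)) (k / h) := fun k =>
    fourier_dilation (fun x : ℝ => f (x + y * I)) hh k
  have hpoisson := Real.tsum_eq_tsum_fourier_of_rpow_decay_of_summable hcont one_lt_two hdecay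
    (by simpa only [hfourier] using hs) 0
  simp only [zero_add, QuotientAddGroup.mk_zero, fourier_eval_zero, mul_one, hfourier] at hpoisson
  rw [← hpoisson, ← tsum_mul_left]
  simp only [hF, real_smul]

theorem norm_trapezoid_sub_integral_le {d h B : ℝ} (hf : DecaysInStrip f (a - d) (a + d))
    (hd : 0 < d) (hh : 0 < h) (hB₁ : ∫ x : ℝ, ‖f (x + (a - d : ℝ) * I)‖ ≤ B)
    (hB₂ : ∫ x : ℝ, ‖f (x + (a + d : ℝ) * I)‖ ≤ B) :
    ‖h * ∑' n : ℤ, f ((n * h : ℝ) + a * I) - ∫ x : ℝ, f (x + a * I)‖ ≤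
      2 * B / (Real.exp (2 * Real.pi * d / h) - 1) := by
  set g : ℝ → ℂ := fun x => f (x + a * I)
  set q := Real.exp (-(2 * Real.pi * d / h)) with hq
  have hq1 : q < 1 := by rw [hq, Real.exp_lt_one_iff]; exact neg_neg_of_pos (by positivity)
  have hbound : ∀ k : ℤ, ‖𝓕 g (k / h)‖ ≤ B * q ^ k.natAbs := by
    intro k
    refine (hf.norm_fourier_line_le hd hB₁ hB₂ _).trans_eq ?_
    rw [hq, ← Real.exp_nat_mul, abs_div, abs_of_pos hh, Nat.cast_natAbs, Int.cast_abs]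
    congr 2
    ring
  have hright : ∀ i : ℕ, ‖𝓕 g ((i + 1 : ℤ) / h)‖ ≤ B * q * q ^ i := fun i => by
    have hnat : ((i : ℤ) + 1).natAbs = i + 1 := by omega
    simpa only [hnat, pow_succ', mul_assoc] using hbound (i + 1)
  have hleft : ∀ i : ℕ, ‖𝓕 g ((-(i + 1) : ℤ) / h)‖ ≤ B * q * q ^ i := fun i => by
    have hnat : (-((i : ℤ) + 1)).natAbs = i + 1 := by omega
    simpa only [hnat, pow_succ', mul_assoc] using hbound (-(i + 1))
  obtain ⟨hs, hle⟩ := norm_tsum_int_sub_sum_range_le (c := fun k : ℤ => 𝓕 g (k / h)) (N := 1)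
    (Real.exp_pos _).le hq1 hright hleft
  have hzero : 𝓕 g 0 = ∫ x : ℝ, g x := by
    simp [Real.fourier_real_eq_integral_exp_smul]
  rw [hf.mul_tsum_line_eq_tsum_fourier (by linarith) ⟨by linarith, by linarith⟩ hh hs, ← hzero]
  simp only [Finset.sum_range_one, Nat.cast_zero, Int.cast_zero, zero_div] at hle
  refine hle.trans_eq ?_
  have hq0 : q ≠ 0 := (Real.exp_pos _).ne'
  have hexp : Real.exp (2 * Real.pi * d / h) = q⁻¹ := by rw [hq, Real.exp_neg, inv_inv]
  have hne : 1 - q ≠ 0 := (sub_pos.2 hq1).ne'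
  have hne' : q⁻¹ - 1 = (1 - q) / q := by field_simp
  rw [hexp, hne', ← hq]
  field_simp
  ring

end DecaysInStrip

theorem exists_norm_polynomial_eval_le (p : Polynomial ℂ) {κ : ℝ} (hκ : 0 < κ) :
    ∃ C, 0 ≤ C ∧ ∀ z : ℂ, ‖p.eval z‖ ≤ C * Real.exp (κ * ‖z‖) := by
  induction p using Polynomial.induction_on' with
  | add p q hp hq =>
    obtain ⟨C, hC, hp⟩ := hp
    obtain ⟨D, hD, hq⟩ := hq
    refine ⟨C + D, by positivity, fun z => ?_⟩
    rw [Polynomial.eval_add, add_mul]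
    exact (norm_add_le _ _).trans (add_le_add (hp z) (hq z))
  | monomial n a =>
    refine ⟨‖a‖ * (n.factorial / κ ^ n), by positivity, fun z => ?_⟩
    have hexp := Real.pow_div_factorial_le_exp (κ * ‖z‖) (by positivity) n
    rw [Polynomial.eval_monomial, norm_mul, norm_pow, mul_assoc]
    gcongr
    rwa [div_mul_eq_mul_div, le_div_iff₀ (by positivity), ← div_le_iff₀' (by positivity),
      ← mul_comm (κ ^ n), ← mul_pow]

theorem exists_pow_mul_exp_neg_le_div_one_add (l : ℕ) {b : ℝ} (hb : 0 < b) :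
    ∃ C, 0 ≤ C ∧ ∀ t : ℝ, 0 ≤ t → t ^ l * Real.exp (-b * t) ≤ C / (1 + t) := by
  obtain ⟨C, hC, h⟩ :=
    exists_norm_polynomial_eval_le (Polynomial.X ^ l * (1 + Polynomial.X)) hb
  refine ⟨C, hC, fun t ht => ?_⟩
  have hnorm : ‖(1 : ℂ) + t‖ = 1 + t := by
    rw [← ofReal_one, ← ofReal_add, norm_real, Real.norm_of_nonneg (by linarith)]
  have ht' := h t
  simp only [Polynomial.eval_mul, Polynomial.eval_pow, Polynomial.eval_X, Polynomial.eval_add,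
    Polynomial.eval_one, norm_mul, norm_pow, norm_real, Real.norm_of_nonneg ht, hnorm] at ht'
  rwa [neg_mul, Real.exp_neg, le_div_iff₀ (by linarith), mul_right_comm, ← div_eq_mul_inv,
    div_le_iff₀ (Real.exp_pos _)]

theorem sq_mul_exp_neg_mul_le {κ y : ℝ} (hκ : 0 < κ) (hy : 0 ≤ y) :
    y ^ 2 * Real.exp (-κ * y) ≤ 2 / κ ^ 2 := by
  have h := Real.pow_div_factorial_le_exp (κ * y) (by positivity) 2
  rw [neg_mul, Real.exp_neg, ← div_eq_mul_inv, div_le_div_iff₀ (Real.exp_pos _) (by positivity)]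
  norm_num [Nat.factorial] at h
  nlinarith

theorem mul_inv_one_sub_exp_neg_le_two {h : ℝ} (hh : 0 < h) (hh' : h ≤ 1) :
    h * (1 - Real.exp (-h))⁻¹ ≤ 2 := by
  have hexp : Real.exp (-h) ≤ (1 + h)⁻¹ := by
    rw [Real.exp_neg]
    exact inv_anti₀ (by linarith) (by linarith [Real.add_one_le_exp h])
  have hsub : (1 + h)⁻¹ = 1 - h / (1 + h) := by field_simp; ring
  have hhalf : h / 2 ≤ h / (1 + h) := by gcongr; linarith
  rw [← div_eq_mul_inv, div_le_iff₀ (by linarith)]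
  linarith

section DoubleExponential

variable {κ : ℝ}

theorem exp_mul_exp_neg_mul_exp_le_exp (hκ : 0 ≤ κ) (x : ℝ) :
    Real.exp x * Real.exp (-κ * Real.exp x) ≤ Real.exp x :=
  mul_le_of_le_one_right (Real.exp_pos x).le
    (Real.exp_le_one_iff.2 (by nlinarith [Real.exp_pos x]))

theorem exp_mul_exp_neg_mul_exp_le_exp_neg (hκ : 0 < κ) (x : ℝ) :
    Real.exp x * Real.exp (-κ * Real.exp x) ≤ 2 / κ ^ 2 * Real.exp (-x) := by
  rw [Real.exp_neg x, ← div_eq_mul_inv, le_div_iff₀ (Real.exp_pos x)]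
  linarith [sq_mul_exp_neg_mul_le hκ (Real.exp_pos x).le]

theorem exp_mul_exp_neg_mul_exp_le (hκ : 0 < κ) (x : ℝ) :
    Real.exp x * Real.exp (-κ * Real.exp x) ≤ (1 + 2 / κ ^ 2) * Real.exp (-|x|) := by
  have hconst : 0 ≤ 2 / κ ^ 2 := by positivity
  rcases le_total x 0 with hx | hx
  · rw [abs_of_nonpos hx, neg_neg]
    nlinarith [exp_mul_exp_neg_mul_exp_le_exp hκ.le x, Real.exp_pos x]
  · rw [abs_of_nonneg hx]
    nlinarith [exp_mul_exp_neg_mul_exp_le_exp_neg hκ x, Real.exp_pos (-x)]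

theorem exp_add_mul_exp_neg_mul_exp_add_le (hκ : 0 < κ) {x y : ℝ} (hx : 0 ≤ x) (hy : 0 ≤ y) :
    Real.exp (x + y) * Real.exp (-κ * Real.exp (x + y)) ≤
      8 / κ ^ 2 * Real.exp (-(κ / 2) * Real.exp x) * Real.exp (-y) := by
  have hhalf : Real.exp (x + y) * Real.exp (-(κ / 2) * Real.exp (x + y)) ≤
      8 / κ ^ 2 * Real.exp (-y) := by
    refine (exp_mul_exp_neg_mul_exp_le_exp_neg (half_pos hκ) (x + y)).trans ?_
    have hconst : 2 / (κ / 2) ^ 2 = 8 / κ ^ 2 := by field_simp; norm_num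
    rw [hconst]
    gcongr
    linarith
  have htail : Real.exp (-(κ / 2) * Real.exp (x + y)) ≤ Real.exp (-(κ / 2) * Real.exp x) := by
    simp only [neg_mul]
    gcongr
    linarith
  calc Real.exp (x + y) * Real.exp (-κ * Real.exp (x + y))
      = Real.exp (x + y) * Real.exp (-(κ / 2) * Real.exp (x + y)) *
          Real.exp (-(κ / 2) * Real.exp (x + y)) := by
        rw [mul_assoc, ← Real.exp_add (-(κ / 2) * _)]
        ring_nf
    _ ≤ 8 / κ ^ 2 * Real.exp (-y) * Real.exp (-(κ / 2) * Real.exp x) := by gcongr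
    _ = 8 / κ ^ 2 * Real.exp (-(κ / 2) * Real.exp x) * Real.exp (-y) := mul_right_comm _ _ _

theorem integrable_exp_mul_exp_neg_mul_exp (hκ : 0 < κ) :
    Integrable fun x : ℝ => Real.exp x * Real.exp (-κ * Real.exp x) := by
  refine ((integrable_exp_neg_mul_abs one_pos).const_mul (1 + 2 / κ ^ 2)).mono'
    (by fun_prop) (Eventually.of_forall fun x => ?_)
  rw [Real.norm_of_nonneg (by positivity), neg_one_mul]
  exact exp_mul_exp_neg_mul_exp_le hκ x

theorem integral_exp_mul_exp_neg_mul_exp (hκ : 0 < κ) :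
    ∫ x : ℝ, Real.exp x * Real.exp (-κ * Real.exp x) = 1 / κ := by
  have hderiv : ∀ x : ℝ, HasDerivAt (fun x => -(1 / κ) * Real.exp (-κ * Real.exp x))
      (Real.exp x * Real.exp (-κ * Real.exp x)) x := fun x =>
    ((((Real.hasDerivAt_exp x).const_mul (-κ)).exp).const_mul (-(1 / κ))).congr_deriv
      (by field_simp)
  have hbot : Tendsto (fun x => -(1 / κ) * Real.exp (-κ * Real.exp x)) atBot (𝓝 (-(1 / κ))) := by
    have hcont : Continuous fun y : ℝ => -(1 / κ) * Real.exp (-κ * y) := by fun_prop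
    simpa [Function.comp_def] using (hcont.tendsto 0).comp Real.tendsto_exp_atBot
  have htop : Tendsto (fun x => -(1 / κ) * Real.exp (-κ * Real.exp x)) atTop (𝓝 0) := by
    have hneg : Tendsto (fun x : ℝ => -κ * Real.exp x) atTop atBot :=
      Real.tendsto_exp_atTop.const_mul_atTop_of_neg (by linarith)
    simpa [Function.comp_def] using (Real.tendsto_exp_atBot.comp hneg).const_mul (-(1 / κ))
  rw [integral_of_hasDerivAt_of_tendsto hderiv (integrable_exp_mul_exp_neg_mul_exp hκ) hbot htop]
  simp

theorem mul_norm_tsum_sub_sum_range_le {E : Type*} [NormedAddCommGroup E] [CompleteSpace E]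
    {c : ℤ → E} {C h : ℝ} (hκ : 0 < κ) (hC : 0 ≤ C) (hh : 0 < h) (hh' : h ≤ 1)
    (hc : ∀ n : ℤ, ‖c n‖ ≤ C * (Real.exp (n * h) * Real.exp (-κ * Real.exp (n * h))))
    (N₁ N₂ : ℕ) :
    h * ‖∑' n, c n - ∑ i ∈ Finset.range (N₁ + N₂), c (i - N₁)‖ ≤
      C * (2 + 16 / κ ^ 2) *
        (Real.exp (-(N₁ * h)) + Real.exp (-(κ / 2) * Real.exp (N₂ * h))) := by
  set X := Real.exp (-(N₁ * h))
  set Y := Real.exp (-(κ / 2) * Real.exp (N₂ * h))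
  have hright : ∀ i : ℕ, ‖c ((i + (N₁ + N₂ : ℕ) : ℤ) - N₁)‖ ≤
      C * (8 / κ ^ 2 * Y) * Real.exp (-h) ^ i := by
    intro i
    have hcast : ((((i + (N₁ + N₂ : ℕ) : ℤ) - N₁ : ℤ) : ℝ)) * h = N₂ * h + i * h := by
      push_cast
      ring
    refine (hc _).trans ?_
    rw [hcast, mul_assoc, ← Real.exp_nat_mul, mul_neg]
    exact mul_le_mul_of_nonneg_left
      (exp_add_mul_exp_neg_mul_exp_add_le hκ (by positivity) (by positivity)) hC
  have hleft : ∀ i : ℕ, ‖c ((-(i + 1) : ℤ) - N₁)‖ ≤ C * X * Real.exp (-h) ^ i := by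
    intro i
    refine (hc _).trans ?_
    rw [mul_assoc, ← Real.exp_nat_mul, ← Real.exp_add (-(N₁ * h))]
    refine mul_le_mul_of_nonneg_left
      ((exp_mul_exp_neg_mul_exp_le_exp hκ.le _).trans (Real.exp_le_exp.2 ?_)) hC
    push_cast
    linarith
  have htail := (norm_tsum_int_sub_sum_range_le (c := fun n => c (n - N₁)) (N := N₁ + N₂)
    (Real.exp_pos _).le (Real.exp_lt_one_iff.2 (by linarith)) hright hleft).2
  have hshift : ∑' n, c (n - N₁) = ∑' n, c n := (Equiv.subRight (N₁ : ℤ)).tsum_eq c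
  rw [hshift] at htail
  calc h * ‖∑' n, c n - ∑ i ∈ Finset.range (N₁ + N₂), c (i - N₁)‖
      ≤ h * ((C * (8 / κ ^ 2 * Y) + C * X) * (1 - Real.exp (-h))⁻¹) := by gcongr
    _ = (C * (8 / κ ^ 2 * Y) + C * X) * (h * (1 - Real.exp (-h))⁻¹) := by ring
    _ ≤ (C * (8 / κ ^ 2 * Y) + C * X) * 2 := by
        gcongr
        exact mul_inv_one_sub_exp_neg_le_two hh hh'
    _ = C * (2 * X + 16 / κ ^ 2 * Y) := by ring
    _ ≤ C * ((2 + 16 / κ ^ 2) * X + (2 + 16 / κ ^ 2) * Y) := by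
        gcongr
        · exact le_add_of_nonneg_right (by positivity)
        · exact le_add_of_nonneg_left zero_le_two
    _ = C * (2 + 16 / κ ^ 2) * (X + Y) := by ring

/-- The finite trapezoidal rule on the line `Im z = a`: the discretization error is governed by the
width of the strip, the truncation errors by the doubly exponential decay to the right and the
exponential decay to the left. -/
theorem DecaysInStrip.norm_trapezoid_range_sub_integral_le {f : ℂ → ℂ} {a d h B C : ℝ}
    (hf : DecaysInStrip f (a - d) (a + d)) (hd : 0 < d) (hh : 0 < h) (hh' : h ≤ 1)
    (hB₁ : ∫ x : ℝ, ‖f (x + (a - d : ℝ) * I)‖ ≤ B) (hB₂ : ∫ x : ℝ, ‖f (x + (a + d : ℝ) * I)‖ ≤ B)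
    (hκ : 0 < κ) (hC : 0 ≤ C)
    (hfC : ∀ x : ℝ, ‖f (x + a * I)‖ ≤ C * (Real.exp x * Real.exp (-κ * Real.exp x)))
    (N₁ N₂ : ℕ) :
    ‖h * ∑ i ∈ Finset.range (N₁ + N₂), f (((i - N₁) * h : ℝ) + a * I) - ∫ x : ℝ, f (x + a * I)‖ ≤
      2 * B / (Real.exp (2 * Real.pi * d / h) - 1) + C * (2 + 16 / κ ^ 2) *
        (Real.exp (-(N₁ * h)) + Real.exp (-(κ / 2) * Real.exp (N₂ * h))) := by
  have htrunc := mul_norm_tsum_sub_sum_range_le (c := fun n : ℤ => f ((n * h : ℝ) + a * I))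
    hκ hC hh hh' (fun n => hfC (n * h)) N₁ N₂
  have htrap := hf.norm_trapezoid_sub_integral_le hd hh hB₁ hB₂
  simp only [Int.cast_sub, Int.cast_natCast] at htrunc
  set S := ∑' n : ℤ, f ((n * h : ℝ) + a * I)
  set S' := ∑ i ∈ Finset.range (N₁ + N₂), f (((i - N₁) * h : ℝ) + a * I)
  have hnorm : ‖h * S' - h * S‖ = h * ‖S - S'‖ := by
    rw [← mul_sub, norm_mul, norm_real, Real.norm_of_nonneg hh.le, norm_sub_rev]
  rw [← hnorm] at htrunc
  rw [add_comm]
  exact (norm_sub_le_norm_sub_add_norm_sub _ _ _).trans (add_le_add htrunc htrap)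

end DoubleExponential

theorem exists_norm_dslope_le {φ : ℂ → ℂ} (hφ : Differentiable ℂ φ) {C : ℝ}
    (hC : ∀ z, ‖φ z‖ ≤ C * (1 + Real.exp z.re)) :
    ∃ D, ∀ z, ‖dslope φ 0 z‖ ≤ D * (1 + Real.exp z.re) := by
  have hd : Differentiable ℂ (dslope φ 0) := by
    rw [← differentiableOn_univ, differentiableOn_dslope univ_mem]
    exact hφ.differentiableOn
  obtain ⟨D, hD⟩ := (isCompact_closedBall (0 : ℂ) 1).exists_bound_of_continuousOn
    hd.continuous.continuousOn
  refine ⟨D + 3 * C, fun z => ?_⟩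
  have hD0 : 0 ≤ D := (norm_nonneg _).trans (hD 0 (by simp))
  have h0 : ‖φ 0‖ ≤ C * 2 := by simpa [one_add_one_eq_two] using hC 0
  have hC0 : 0 ≤ C := by linarith [norm_nonneg (φ 0)]
  have hexp := Real.exp_pos z.re
  rcases le_or_gt ‖z‖ 1 with hz | hz
  · nlinarith [hD z (by simpa using hz)]
  · have hz0 : z ≠ 0 := norm_pos_iff.1 (one_pos.trans hz)
    rw [dslope_of_ne _ hz0, slope_def_field, norm_div, sub_zero]
    refine (div_le_self (norm_nonneg _) hz.le).trans ((norm_sub_le _ _).trans ?_)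
    nlinarith [hC z]

theorem exists_exp_eq_sum_add_pow_mul (m : ℕ) :
    ∃ (c : ℕ → ℂ) (φ : ℂ → ℂ) (C : ℝ), Differentiable ℂ φ ∧
      (∀ z, ‖φ z‖ ≤ C * (1 + Real.exp z.re)) ∧
      ∀ z, exp z = ∑ l ∈ Finset.range m, c l * z ^ l + z ^ m * φ z := by
  induction m with
  | zero =>
    refine ⟨0, exp, 1, differentiable_exp, fun z => ?_, fun z => by simp⟩
    rw [norm_exp]
    linarith
  | succ m ih =>
    obtain ⟨c, φ, C, hφ, hC, hexp⟩ := ih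
    obtain ⟨D, hD⟩ := exists_norm_dslope_le hφ hC
    refine ⟨Function.update c m (φ 0), dslope φ 0, D, ?_, hD, fun z => ?_⟩
    · rw [← differentiableOn_univ, differentiableOn_dslope univ_mem]
      exact hφ.differentiableOn
    · have hφz : φ z = φ 0 + z * dslope φ 0 z := by
        simpa [add_comm, eq_sub_iff_add_eq, eq_comm] using sub_smul_dslope φ 0 z
      have hc : ∑ l ∈ Finset.range m, Function.update c m (φ 0) l * z ^ l =
          ∑ l ∈ Finset.range m, c l * z ^ l :=
        Finset.sum_congr rfl fun l hl => by
          rw [Function.update_of_ne (Finset.mem_range.1 hl).ne]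
      rw [Finset.sum_range_succ, hc, Function.update_self, hexp z, hφz]
      ring

/-- The monic polynomial, as a function of `w`, vanishing to order `m` at each point of `Z`. -/
noncomputable def nodal (Z : Finset ℂ) (m : ℕ) (w : ℂ) : ℂ := ∏ a ∈ Z, (w - a) ^ m

/-- Hermite interpolation of the entire functions `w ↦ exp (I * w * t)`, for all real `t` at once,
at the nodes `Z`, each of multiplicity `m`. The interpolation polynomial is written as a
combination of the functions `t ^ l * exp (I * a * t)` of `t`, whose coefficients are
polynomials in `w` independent of `t`. -/
structure ExpInterpolation (Z : Finset ℂ) (m : ℕ) where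
  /-- The coefficient of `t ^ i.2 * exp (I * i.1 * t)`. -/
  coeff : ℂ × ℕ → Polynomial ℂ
  /-- The interpolation error divided by the nodal polynomial. -/
  remainder : ℝ → ℂ → ℂ
  differentiable_remainder : ∀ t, Differentiable ℂ (remainder t)
  exists_norm_remainder_le : ∀ κ t : ℝ, 0 < κ → 0 ≤ t →
    ∃ C, ∀ w : ℂ, 0 ≤ w.im → ‖remainder t w‖ ≤ C * Real.exp (κ * ‖w‖)
  exp_eq : ∀ (t : ℝ) (w : ℂ), exp (I * w * t) =
    ∑ i ∈ Z ×ˢ Finset.range m, (t : ℂ) ^ i.2 * exp (I * i.1 * t) * (coeff i).eval w +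
      nodal Z m w * remainder t w

namespace ExpInterpolation

theorem exists_cofactors {Z : Finset ℂ} (hZ : Z.Nonempty) (m : ℕ) :
    ∃ μ : ℂ → Polynomial ℂ, ∀ w, ∑ a ∈ Z, (μ a).eval w * ∏ b ∈ Z.erase a, (w - b) ^ m = 1 := by
  classical
  obtain ⟨μ, hμ⟩ := (exists_sum_eq_one_iff_pairwise_coprime (t := Z)
    (s := fun a : ℂ => (Polynomial.X - Polynomial.C a) ^ m) hZ).2 fun a b hab =>
      (Polynomial.isCoprime_X_sub_C_of_isUnit_sub
        (sub_ne_zero.2 fun h => hab (Subtype.ext h)).isUnit).pow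
  refine ⟨μ, fun w => ?_⟩
  simpa [Polynomial.eval_finsetSum, Polynomial.eval_prod, Finset.sdiff_singleton_eq_erase]
    using congrArg (Polynomial.eval w) hμ

theorem exists_norm_cofactor_mul_le (p : Polynomial ℂ) {φ : ℂ → ℂ} {C : ℝ}
    (hC : ∀ z, ‖φ z‖ ≤ C * (1 + Real.exp z.re)) (a c : ℂ) {κ t : ℝ} (hκ : 0 < κ) (ht : 0 ≤ t) :
    ∃ D, ∀ w : ℂ, 0 ≤ w.im →
      ‖p.eval w * (c * φ (I * t * (w - a)))‖ ≤ D * Real.exp (κ * ‖w‖) := by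
  obtain ⟨D, hD, hp⟩ := exists_norm_polynomial_eval_le p hκ
  have hC0 : 0 ≤ C := by
    have := (norm_nonneg _).trans (hC 0)
    simpa [one_add_one_eq_two] using this
  refine ⟨D * (‖c‖ * (C * (1 + Real.exp (t * a.im)))), fun w hw => ?_⟩
  have hre : (I * t * (w - a)).re ≤ t * a.im := by
    have : 0 ≤ t * w.im := mul_nonneg ht hw
    simp only [mul_re, mul_im, sub_re, sub_im, I_re, I_im, ofReal_re, ofReal_im]
    linarith
  calc ‖p.eval w * (c * φ (I * t * (w - a)))‖
      = ‖p.eval w‖ * (‖c‖ * ‖φ (I * t * (w - a))‖) := by rw [norm_mul, norm_mul]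
    _ ≤ D * Real.exp (κ * ‖w‖) * (‖c‖ * (C * (1 + Real.exp (t * a.im)))) := by
        gcongr
        · exact hp w
        · exact (hC _).trans (by gcongr)
    _ = _ := by ring

protected theorem nonempty_of_nonempty {Z : Finset ℂ} (hZ : Z.Nonempty) (m : ℕ) :
    Nonempty (ExpInterpolation Z m) := by
  obtain ⟨μ, hμ⟩ := exists_cofactors hZ m
  obtain ⟨c, φ, C, hφ, hC, hexp⟩ := exists_exp_eq_sum_add_pow_mul m
  refine ⟨{
    coeff i := Polynomial.C (c i.2 * I ^ i.2) * (μ i.1 * ∏ b ∈ Z.erase i.1,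
      (Polynomial.X - Polynomial.C b) ^ m) * (Polynomial.X - Polynomial.C i.1) ^ i.2
    remainder t w := ∑ a ∈ Z, (μ a).eval w *
      ((I * t) ^ m * exp (I * a * t) * φ (I * t * (w - a)))
    differentiable_remainder t := Differentiable.fun_sum fun a _ =>
      (Polynomial.differentiable _).mul ((differentiable_const _).mul (hφ.comp (by fun_prop)))
    exists_norm_remainder_le κ t hκ ht := ?_
    exp_eq t w := ?_ }⟩
  · choose D hD using fun a => exists_norm_cofactor_mul_le (μ a) hC a
      ((I * t) ^ m * exp (I * a * t)) hκ ht
    refine ⟨∑ a ∈ Z, D a, fun w hw => ?_⟩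
    rw [Finset.sum_mul]
    exact (norm_sum_le _ _).trans (Finset.sum_le_sum fun a _ => hD a w hw)
  · rw [Finset.sum_product, Finset.mul_sum, ← Finset.sum_add_distrib,
      ← one_mul (exp (I * w * t)), ← hμ w, Finset.sum_mul]
    refine Finset.sum_congr rfl fun a ha => ?_
    have hexp_add : exp (I * w * t) = exp (I * a * t) * exp (I * t * (w - a)) := by
      rw [← exp_add]
      ring_nf
    rw [nodal, ← Finset.mul_prod_erase Z (fun b => (w - b) ^ m) ha, hexp_add,
      hexp (I * t * (w - a)), mul_add, mul_add, Finset.mul_sum, Finset.mul_sum]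
    congr 1
    · refine Finset.sum_congr rfl fun l _ => ?_
      simp only [Polynomial.eval_mul, Polynomial.eval_C, Polynomial.eval_prod,
        Polynomial.eval_pow, Polynomial.eval_sub, Polynomial.eval_X, mul_pow]
      ring
    · rw [mul_pow (I * (t : ℂ)) (w - a)]
      ring

instance (Z : Finset ℂ) (m : ℕ) : Nonempty (ExpInterpolation Z m) := by
  rcases Z.eq_empty_or_nonempty with rfl | hZ
  · refine ⟨{
      coeff := 0
      remainder t w := exp (I * w * t)
      differentiable_remainder t := by fun_prop
      exists_norm_remainder_le κ t hκ ht := ⟨1, fun w hw => ?_⟩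
      exp_eq t w := by simp [nodal] }⟩
    rw [norm_exp, one_mul]
    refine Real.exp_le_exp.2 (le_trans ?_ (by positivity : 0 ≤ κ * ‖w‖))
    simpa using mul_nonneg hw ht
  · exact ExpInterpolation.nonempty_of_nonempty hZ m

end ExpInterpolation

/-- `p` is a sum of `N` non-growing complex exponentials. -/
def IsExpSum (N : ℕ) (p : ℝ → ℂ) : Prop :=
  ∃ g ω : Fin N → ℂ, (∀ k, 0 ≤ (ω k).im) ∧ ∀ t, p t = ∑ k, g k * exp (I * ω k * t)

namespace IsExpSum

variable {M N : ℕ} {p q : ℝ → ℂ}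

theorem zero : IsExpSum 0 fun _ => 0 := ⟨0, 0, fun k => k.elim0, fun t => by simp⟩

theorem exp_mul (g : ℂ) {ω : ℂ} (hω : 0 ≤ ω.im) : IsExpSum 1 fun t => g * exp (I * ω * t) :=
  ⟨fun _ => g, fun _ => ω, fun _ => hω, fun t => by simp⟩

theorem add (hp : IsExpSum M p) (hq : IsExpSum N q) : IsExpSum (M + N) fun t => p t + q t := by
  obtain ⟨g, ω, hω, hp⟩ := hp
  obtain ⟨g', ω', hω', hq⟩ := hq
  refine ⟨Fin.append g g', Fin.append ω ω', fun k => ?_, fun t => ?_⟩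
  · refine Fin.addCases (fun i => ?_) (fun i => ?_) k
    · simpa using hω i
    · simpa using hω' i
  · simp [Fin.sum_univ_add, hp, hq]

theorem const_mul (hp : IsExpSum N p) (c : ℂ) : IsExpSum N fun t => c * p t := by
  obtain ⟨g, ω, hω, hp⟩ := hp
  exact ⟨fun k => c * g k, ω, hω, fun t => by simp [hp, Finset.mul_sum, mul_assoc]⟩

theorem sum {ι : Type*} (s : Finset ι) {N : ι → ℕ} {p : ι → ℝ → ℂ}
    (h : ∀ i ∈ s, IsExpSum (N i) (p i)) : IsExpSum (∑ i ∈ s, N i) fun t => ∑ i ∈ s, p i t := by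
  classical
  induction s using Finset.induction_on with
  | empty => simpa using zero
  | insert a s ha ih =>
    simp only [Finset.sum_insert ha]
    exact (h a (Finset.mem_insert_self _ _)).add
      (ih fun i hi => h i (Finset.mem_insert_of_mem hi))

theorem continuous (hp : IsExpSum N p) : Continuous p := by
  obtain ⟨g, ω, -, hp⟩ := hp
  rw [funext hp]
  fun_prop

end IsExpSum

/-- `f` is a uniform limit on `[0, T]` of sums of `N` non-growing complex exponentials. Such
limits include the functions `t ^ l * exp (I * a * t)`, which are not themselves such sums. -/
def IsExpSumLimit (T : ℝ) (N : ℕ) (f : ℝ → ℂ) : Prop :=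
  ∀ η : ℝ, 0 < η → ∃ p, IsExpSum N p ∧ ∀ t ∈ Set.Icc 0 T, ‖f t - p t‖ ≤ η

theorem norm_mul_exp_sub_difference_quotient_le {a : ℂ} (ha : 0 ≤ a.im) {σ t : ℝ} (hσ : 0 < σ)
    (ht : 0 ≤ t) (hσt : σ * t ≤ 1) :
    ‖t * exp (I * a * t) - (1 / (I * σ) * exp (I * (a + σ) * t) +
      -(1 / (I * σ)) * exp (I * a * t))‖ ≤ σ * t ^ 2 := by
  have hnorm : ‖I * σ * t‖ = σ * t := by simp [abs_of_pos hσ, abs_of_nonneg ht]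
  have hσ0 : (σ : ℂ) ≠ 0 := ofReal_ne_zero.2 hσ.ne'
  have hexp : exp (I * (a + σ) * t) = exp (I * a * t) * exp (I * σ * t) := by
    rw [← exp_add]
    ring_nf
  have hle_one : ‖exp (I * a * t)‖ ≤ 1 := by
    rw [norm_exp, Real.exp_le_one_iff]
    simpa using mul_nonneg ha ht
  have hquot : t * exp (I * a * t) - (1 / (I * σ) * exp (I * (a + σ) * t) +
      -(1 / (I * σ)) * exp (I * a * t)) =
      -(exp (I * a * t) * (exp (I * σ * t) - 1 - I * σ * t) / (I * σ)) := by
    rw [hexp]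
    field_simp
    ring
  rw [hquot, norm_neg, norm_div, norm_mul, norm_mul, norm_I, one_mul, norm_real,
    Real.norm_of_nonneg hσ.le, div_le_iff₀ hσ]
  calc ‖exp (I * a * t)‖ * ‖exp (I * σ * t) - 1 - I * σ * t‖
      ≤ 1 * ‖I * σ * t‖ ^ 2 :=
        mul_le_mul hle_one (norm_exp_sub_one_sub_id_le (hnorm.trans_le hσt)) (norm_nonneg _)
          zero_le_one
    _ = σ * t ^ 2 * σ := by
        rw [hnorm]
        ring

namespace IsExpSumLimit

variable {T : ℝ} {M N : ℕ} {p q f : ℝ → ℂ}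

theorem of_isExpSum (hp : IsExpSum N p) : IsExpSumLimit T N p :=
  fun η hη => ⟨p, hp, fun t _ => by simpa using hη.le⟩

theorem add (hp : IsExpSumLimit T M p) (hq : IsExpSumLimit T N q) :
    IsExpSumLimit T (M + N) fun t => p t + q t := by
  intro η hη
  obtain ⟨p', hp', hpp'⟩ := hp (η / 2) (half_pos hη)
  obtain ⟨q', hq', hqq'⟩ := hq (η / 2) (half_pos hη)
  refine ⟨_, hp'.add hq', fun t ht => ?_⟩
  rw [add_sub_add_comm]
  exact (norm_add_le _ _).trans (by linarith [hpp' t ht, hqq' t ht])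

theorem const_mul (hp : IsExpSumLimit T N p) (c : ℂ) : IsExpSumLimit T N fun t => c * p t := by
  intro η hη
  obtain ⟨p', hp', hpp'⟩ := hp (η / (‖c‖ + 1)) (by positivity)
  refine ⟨_, hp'.const_mul c, fun t ht => ?_⟩
  have := hpp' t ht
  rw [le_div_iff₀ (by positivity)] at this
  rw [← mul_sub, norm_mul]
  nlinarith [norm_nonneg (p t - p' t)]

theorem sum {ι : Type*} (s : Finset ι) {N : ι → ℕ} {p : ι → ℝ → ℂ}
    (h : ∀ i ∈ s, IsExpSumLimit T (N i) (p i)) :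
    IsExpSumLimit T (∑ i ∈ s, N i) fun t => ∑ i ∈ s, p i t := by
  classical
  induction s using Finset.induction_on with
  | empty => simpa using of_isExpSum IsExpSum.zero
  | insert a s ha ih =>
    simp only [Finset.sum_insert ha]
    exact (h a (Finset.mem_insert_self _ _)).add
      (ih fun i hi => h i (Finset.mem_insert_of_mem hi))

theorem of_limit (h : ∀ η : ℝ, 0 < η →
    ∃ g, IsExpSumLimit T N g ∧ ∀ t ∈ Set.Icc 0 T, ‖f t - g t‖ ≤ η) : IsExpSumLimit T N f := by
  intro η hη
  obtain ⟨g, hg, hfg⟩ := h (η / 2) (half_pos hη)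
  obtain ⟨p, hp, hgp⟩ := hg (η / 2) (half_pos hη)
  refine ⟨p, hp, fun t ht => ?_⟩
  rw [← sub_add_sub_cancel _ (g t)]
  exact (norm_add_le _ _).trans (by linarith [hfg t ht, hgp t ht])

theorem pow_mul_exp (T : ℝ) (l : ℕ) {a : ℂ} (ha : 0 ≤ a.im) :
    IsExpSumLimit T (2 ^ l) fun t => (t : ℂ) ^ l * exp (I * a * t) := by
  induction l generalizing a with
  | zero => simpa using of_isExpSum (T := T) (IsExpSum.exp_mul 1 ha)
  | succ l ih =>
    refine of_limit fun η hη => ?_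
    set S := |T| + 1
    have hS : 0 < S := by positivity
    set σ := min (1 / S) (η / S ^ (l + 2))
    have hσ : 0 < σ := by positivity
    have hσ_inv : σ * S ≤ 1 := (le_div_iff₀ hS).1 (min_le_left _ _)
    have hσ_pow : σ * S ^ (l + 2) ≤ η := (le_div_iff₀ (by positivity)).1 (min_le_right _ _)
    have hlim := ((ih (a := a + σ) (by simpa using ha)).const_mul (1 / (I * σ))).add
      ((ih ha).const_mul (-(1 / (I * σ))))
    rw [← mul_two, ← pow_succ] at hlim
    refine ⟨_, hlim, fun t ht => ?_⟩
    have ht0 : 0 ≤ t := ht.1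
    have htS : t ≤ S := by linarith [ht.2, le_abs_self T]
    calc _ = ‖(t : ℂ) ^ l * (t * exp (I * a * t) - (1 / (I * σ) * exp (I * (a + σ) * t) +
            -(1 / (I * σ)) * exp (I * a * t)))‖ := by ring_nf
      _ ≤ t ^ l * (σ * t ^ 2) := by
          rw [norm_mul, norm_pow, norm_real, Real.norm_of_nonneg ht0]
          gcongr
          exact norm_mul_exp_sub_difference_quotient_le ha hσ ht0
            ((mul_le_mul_of_nonneg_left htS hσ.le).trans hσ_inv)
      _ = σ * t ^ (l + 2) := by ring
      _ ≤ σ * S ^ (l + 2) := by gcongr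
      _ ≤ η := hσ_pow

end IsExpSumLimit

theorem norm_exp_add_mul_I (x α : ℝ) : ‖exp (x + α * I)‖ = Real.exp x := by simp [norm_exp]

theorem norm_exp_I_mul_exp_mul (x α t : ℝ) :
    ‖exp (I * exp (x + α * I) * t)‖ = Real.exp (-(t * Real.sin α) * Real.exp x) := by
  rw [norm_exp, re_mul_ofReal, I_mul_re, exp_im]
  simp only [add_re, add_im, ofReal_re, ofReal_im, re_ofReal_mul, im_ofReal_mul, I_re, I_im]
  ring_nf

theorem im_exp_nonneg {u : ℂ} (hu : u.im ∈ Set.Icc 0 Real.pi) : 0 ≤ (exp u).im := by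
  rw [exp_im]
  exact mul_nonneg (Real.exp_pos _).le (Real.sin_nonneg_of_mem_Icc hu)

theorem im_pos_of_arg_mem {z : ℂ} (hz : z.arg ∈ Set.Ioo 0 Real.pi) : 0 < z.im := by
  rw [← norm_mul_sin_arg]
  refine mul_pos (norm_pos_iff.2 ?_) (Real.sin_pos_of_mem_Ioo hz)
  rintro rfl
  simp at hz

theorem abs_im_mul_exp_neg_le_norm_exp_sub (a : ℂ) (x θ : ℝ) :
    |(a * exp (-(θ * I))).im| ≤ ‖exp (x + θ * I) - a‖ := by
  have hrot : exp (x + θ * I) - a = -(exp (θ * I) * (a * exp (-(θ * I)) - Real.exp x)) := by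
    rw [mul_sub, mul_left_comm, ← exp_add, add_neg_cancel, exp_zero, exp_add, ofReal_exp]
    ring
  rw [hrot, norm_neg, norm_mul, norm_exp_ofReal_mul_I, one_mul]
  simpa using abs_im_le_norm (a * exp (-(θ * I)) - Real.exp x)

theorem im_mul_exp_neg_ne_zero {a : ℂ} (ha : a.arg ∈ Set.Ioo 0 Real.pi) {θ : ℝ}
    (hθ : θ ∈ Set.Ico 0 Real.pi) (hne : a.arg ≠ θ) : (a * exp (-(θ * I))).im ≠ 0 := by
  have ha0 : a ≠ 0 := by
    rintro rfl
    simp at ha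
  have him : (a * exp (-(θ * I))).im = ‖a‖ * Real.sin (a.arg - θ) := by
    conv_lhs => rw [← norm_mul_exp_arg_mul_I a, mul_assoc, ← exp_add]
    rw [im_ofReal_mul, ← sub_eq_add_neg, ← sub_mul, ← ofReal_sub, exp_ofReal_mul_I_im]
  rw [him]
  refine mul_ne_zero (norm_ne_zero_iff.2 ha0) fun hsin => hne (sub_eq_zero.1 ?_)
  exact (Real.sin_eq_zero_iff_of_lt_of_lt (by linarith [ha.1, hθ.2])
    (by linarith [ha.2, hθ.1])).1 hsin

theorem exists_le_norm_nodal_exp (Z : Finset ℂ) (m : ℕ) {θ : ℝ} (hθ : θ ∈ Set.Ico 0 Real.pi)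
    (hZ : ∀ a ∈ Z, a.arg ∈ Set.Ioo 0 Real.pi ∧ a.arg ≠ θ) :
    ∃ c, 0 < c ∧ ∀ x : ℝ, c ≤ ‖nodal Z m (exp (x + θ * I))‖ := by
  refine ⟨∏ a ∈ Z, |(a * exp (-(θ * I))).im| ^ m, Finset.prod_pos fun a ha =>
    pow_pos (abs_pos.2 (im_mul_exp_neg_ne_zero (hZ a ha).1 hθ (hZ a ha).2)) _, fun x => ?_⟩
  rw [nodal, norm_prod]
  refine Finset.prod_le_prod (fun a _ => by positivity) fun a _ => ?_
  rw [norm_pow]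
  exact pow_le_pow_left₀ (abs_nonneg _) (abs_im_mul_exp_neg_le_norm_exp_sub a x θ) m

theorem continuous_nodal (Z : Finset ℂ) (m : ℕ) : Continuous (nodal Z m) := by
  unfold nodal
  fun_prop

/-- `A` is continuous on the closed sector `0 ≤ arg w ≤ α`, analytic inside, and bounded there by
`C * exp (-κ * ‖w‖)`. The conditions are expressed in the coordinate `u` with `w = exp u`, so that
they say nothing about the vertex `0`. -/
structure DecaysInSector (A : ℂ → ℂ) (α C κ : ℝ) : Prop where
  diffContOnCl : DiffContOnCl ℂ (fun u => A (exp u)) (im ⁻¹' Set.Ioo 0 α)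
  norm_le : ∀ u : ℂ, u.im ∈ Set.Icc 0 α → ‖A (exp u)‖ ≤ C * Real.exp (-κ * Real.exp u.re)

theorem DecaysInSector.decaysInStrip {A φ : ℂ → ℂ} {α C D κ : ℝ} (hA : DecaysInSector A α C κ)
    (hα : 0 ≤ α) (hα' : α ≤ Real.pi) (hκ : 0 < κ) (hφ : Differentiable ℂ φ)
    (hφD : ∀ w : ℂ, 0 ≤ w.im → ‖φ w‖ ≤ D * Real.exp (κ / 2 * ‖w‖)) :
    DecaysInStrip (fun u => A (exp u) * φ (exp u) * exp u) 0 α := by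
  have hC : 0 ≤ C := nonneg_of_mul_nonneg_left
    ((norm_nonneg _).trans (hA.norm_le 0 (by simpa using hα))) (Real.exp_pos _)
  have hD : 0 ≤ D := nonneg_of_mul_nonneg_left
    ((norm_nonneg _).trans (hφD 0 le_rfl)) (Real.exp_pos _)
  refine ⟨?_, C * D * (1 + 2 / (κ / 2) ^ 2), 1, one_pos, fun u hu => ?_⟩
  · simp only [mul_assoc]
    exact hA.diffContOnCl.smul
      (((hφ.comp differentiable_exp).mul differentiable_exp).diffContOnCl)
  · have hφu := hφD (exp u) (im_exp_nonneg ⟨hu.1, hu.2.trans hα'⟩)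
    rw [norm_exp] at hφu
    have hexp : Real.exp (-(κ / 2) * Real.exp u.re) =
        Real.exp (-κ * Real.exp u.re) * Real.exp (κ / 2 * Real.exp u.re) := by
      rw [← Real.exp_add]
      ring_nf
    calc ‖A (exp u) * φ (exp u) * exp u‖
        = ‖A (exp u)‖ * ‖φ (exp u)‖ * Real.exp u.re := by rw [norm_mul, norm_mul, norm_exp]
      _ ≤ C * Real.exp (-κ * Real.exp u.re) * (D * Real.exp (κ / 2 * Real.exp u.re)) *
            Real.exp u.re := by
          gcongr
          exact hA.norm_le u hu
      _ = C * D * (Real.exp u.re * Real.exp (-(κ / 2) * Real.exp u.re)) := by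
          rw [hexp]
          ring
      _ ≤ C * D * ((1 + 2 / (κ / 2) ^ 2) * Real.exp (-|u.re|)) := by
          exact mul_le_mul_of_nonneg_left (exp_mul_exp_neg_mul_exp_le (half_pos hκ) _)
            (by positivity)
      _ = _ := by
          rw [neg_one_mul]
          ring

namespace ExpInterpolation

variable {Z : Finset ℂ} {m : ℕ} (H : ExpInterpolation Z m)

/-- The Hermite interpolation polynomial of `w ↦ exp (I * w * t)`. -/
noncomputable def interpolant (t : ℝ) (w : ℂ) : ℂ :=
  ∑ i ∈ Z ×ˢ Finset.range m, (t : ℂ) ^ i.2 * exp (I * i.1 * t) * (H.coeff i).eval w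

/-- The differential form `A(w) R_t(w) dw` in the coordinate `u` with `w = exp u`, where `R_t` is
the interpolation remainder. -/
noncomputable def logIntegrand (A : ℂ → ℂ) (t : ℝ) (u : ℂ) : ℂ :=
  A (exp u) * H.remainder t (exp u) * exp u

theorem logIntegrand_eq (A : ℂ → ℂ) (t : ℝ) {u : ℂ} (hu : nodal Z m (exp u) ≠ 0) :
    H.logIntegrand A t u = A (exp u) / nodal Z m (exp u) * exp u *
      (exp (I * exp u * t) - H.interpolant t (exp u)) := by
  rw [logIntegrand, H.exp_eq, interpolant, add_sub_cancel_left]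
  field_simp

theorem exists_norm_interpolant_le (hZ : ∀ a ∈ Z, 0 < a.im) {κ : ℝ} (hκ : 0 < κ) :
    ∃ C, ∀ (t : ℝ) (w : ℂ), 0 ≤ t →
      ‖H.interpolant t w‖ ≤ C / (1 + t) * Real.exp (κ * ‖w‖) := by
  have hterm : ∀ i ∈ Z ×ˢ Finset.range m, ∃ C, ∀ (t : ℝ) (w : ℂ), 0 ≤ t →
      ‖(t : ℂ) ^ i.2 * exp (I * i.1 * t) * (H.coeff i).eval w‖ ≤
        C / (1 + t) * Real.exp (κ * ‖w‖) := by
    intro i hi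
    obtain ⟨D, -, hcoeff⟩ := exists_norm_polynomial_eval_le (H.coeff i) hκ
    obtain ⟨B, hB, hpow⟩ :=
      exists_pow_mul_exp_neg_le_div_one_add i.2 (hZ _ (Finset.mem_product.1 hi).1)
    refine ⟨B * D, fun t w ht => ?_⟩
    have hnorm : ‖(t : ℂ) ^ i.2 * exp (I * i.1 * t)‖ = t ^ i.2 * Real.exp (-i.1.im * t) := by
      simp [norm_exp, abs_of_nonneg ht]
    rw [norm_mul, hnorm]
    exact (mul_le_mul (hpow t ht) (hcoeff w) (norm_nonneg _) (by positivity)).trans_eq (by ring)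
  choose! C hle using hterm
  refine ⟨∑ i ∈ Z ×ˢ Finset.range m, C i, fun t w ht => ?_⟩
  rw [Finset.sum_div, Finset.sum_mul]
  exact (norm_sum_le _ _).trans (Finset.sum_le_sum fun i hi => hle i hi t w ht)

theorem decaysInStrip_logIntegrand {A : ℂ → ℂ} {α C κ : ℝ} (hA : DecaysInSector A α C κ)
    (hα : 0 ≤ α) (hα' : α ≤ Real.pi) (hκ : 0 < κ) {t : ℝ} (ht : 0 ≤ t) :
    DecaysInStrip (H.logIntegrand A t) 0 α := by
  obtain ⟨D, hD⟩ := H.exists_norm_remainder_le (κ / 2) t (half_pos hκ) ht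
  exact hA.decaysInStrip hα hα' hκ (H.differentiable_remainder t) hD

theorem exists_norm_logIntegrand_ray_le (hZ : ∀ a ∈ Z, 0 < a.im) {α γ C κ : ℝ} (hC : 0 ≤ C)
    (hκ : 0 < κ) (hα : α ∈ Set.Icc 0 γ)
    (hnodal : ∃ c, 0 < c ∧ ∀ x : ℝ, c ≤ ‖nodal Z m (exp (x + α * I))‖) :
    ∃ K, 0 ≤ K ∧ ∀ A, DecaysInSector A γ C κ → ∀ t : ℝ, 0 ≤ t → ∀ x : ℝ,
      ‖H.logIntegrand A t (x + α * I)‖ ≤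
        K * (Real.exp x * Real.exp (-(κ + t * Real.sin α) * Real.exp x) +
          1 / (1 + t) * (Real.exp x * Real.exp (-(κ / 2) * Real.exp x))) := by
  obtain ⟨c, hc, hnodal⟩ := hnodal
  obtain ⟨D, hinterp⟩ := H.exists_norm_interpolant_le hZ (half_pos hκ)
  refine ⟨C / c * max 1 D, by positivity, fun A hA t ht x => ?_⟩
  set y := Real.exp x with hy
  have hsub : ‖exp (I * exp (x + α * I) * t) - H.interpolant t (exp (x + α * I))‖ ≤
      max 1 D * (Real.exp (-(t * Real.sin α) * y) + 1 / (1 + t) * Real.exp (κ / 2 * y)) := by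
    have hi := hinterp t (exp (x + α * I)) ht
    rw [norm_exp_add_mul_I] at hi
    rw [mul_add]
    refine (norm_sub_le _ _).trans (add_le_add ?_ (hi.trans ?_))
    · rw [norm_exp_I_mul_exp_mul]
      exact le_mul_of_one_le_left (Real.exp_pos _).le (le_max_left _ _)
    · rw [← mul_assoc, mul_one_div]
      gcongr
      exact le_max_right _ _
  have hAx : ‖A (exp (x + α * I)) / nodal Z m (exp (x + α * I))‖ ≤
      C / c * Real.exp (-κ * y) := by
    rw [norm_div, div_mul_eq_mul_div]
    exact div_le_div₀ (by positivity) (by simpa using hA.norm_le (x + α * I) (by simpa using hα))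
      hc (hnodal x)
  rw [H.logIntegrand_eq A t (norm_pos_iff.1 (hc.trans_le (hnodal x))), norm_mul, norm_mul,
    norm_exp_add_mul_I, ← hy]
  calc _ ≤ C / c * Real.exp (-κ * y) * y *
        (max 1 D * (Real.exp (-(t * Real.sin α) * y) + 1 / (1 + t) * Real.exp (κ / 2 * y))) := by
        gcongr
    _ = C / c * max 1 D * (y * (Real.exp (-κ * y) * Real.exp (-(t * Real.sin α) * y)) +
          1 / (1 + t) * (y * (Real.exp (-κ * y) * Real.exp (κ / 2 * y)))) := by ring
    _ = _ := by
        rw [← Real.exp_add (-κ * y), ← Real.exp_add (-κ * y)]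
        ring_nf

end ExpInterpolation

theorem integral_norm_le_div_one_add {f : ℝ → ℂ} {K κ σ t : ℝ} (hK : 0 ≤ K) (hκ : 0 < κ)
    (hσ : 0 < σ) (ht : 0 ≤ t)
    (hf : ∀ x, ‖f x‖ ≤ K * (Real.exp x * Real.exp (-(κ + t * σ) * Real.exp x) +
      1 / (1 + t) * (Real.exp x * Real.exp (-(κ / 2) * Real.exp x)))) :
    ∫ x : ℝ, ‖f x‖ ≤ K * (1 / κ + 1 / σ + 2 / κ) / (1 + t) := by
  have hκt : 0 < κ + t * σ := by positivity
  have hint₁ := integrable_exp_mul_exp_neg_mul_exp hκt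
  have hint₂ := (integrable_exp_mul_exp_neg_mul_exp (half_pos hκ)).const_mul (1 / (1 + t))
  have hκσ : 1 / (κ + t * σ) ≤ (1 / κ + 1 / σ) / (1 + t) := by
    rw [div_le_div_iff₀ hκt (by positivity)]
    have hexpand : (1 / κ + 1 / σ) * (κ + t * σ) = 1 * (1 + t) + t * (σ / κ) + κ / σ := by
      field_simp
      ring
    rw [hexpand]
    linarith [mul_nonneg ht (div_nonneg hσ.le hκ.le), div_nonneg hκ.le hσ.le]
  calc ∫ x : ℝ, ‖f x‖
      ≤ ∫ x : ℝ, K * (Real.exp x * Real.exp (-(κ + t * σ) * Real.exp x) +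
          1 / (1 + t) * (Real.exp x * Real.exp (-(κ / 2) * Real.exp x))) :=
        integral_mono_of_nonneg (Eventually.of_forall fun x => norm_nonneg _)
          ((hint₁.add hint₂).const_mul K) (Eventually.of_forall hf)
    _ = K * (1 / (κ + t * σ) + 1 / (1 + t) * (1 / (κ / 2))) := by
        rw [integral_const_mul, integral_add hint₁ hint₂, integral_const_mul,
          integral_exp_mul_exp_neg_mul_exp hκt, integral_exp_mul_exp_neg_mul_exp (half_pos hκ)]
    _ ≤ K * ((1 / κ + 1 / σ) / (1 + t) + 1 / (1 + t) * (1 / (κ / 2))) := by gcongr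
    _ = _ := by
        field_simp

namespace ExpInterpolation

variable {Z : Finset ℂ} {m : ℕ} (H : ExpInterpolation Z m)

theorem exists_integral_norm_logIntegrand_le (hZ : ∀ a ∈ Z, 0 < a.im) {α γ C κ : ℝ} (hC : 0 ≤ C)
    (hκ : 0 < κ) (hα : α ∈ Set.Ioo 0 Real.pi) (hαγ : α ≤ γ)
    (hnodal : ∃ c, 0 < c ∧ ∀ x : ℝ, c ≤ ‖nodal Z m (exp (x + α * I))‖) :
    ∃ B, 0 ≤ B ∧ ∀ A, DecaysInSector A γ C κ → ∀ t : ℝ, 0 ≤ t →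
      ∫ x : ℝ, ‖H.logIntegrand A t (x + α * I)‖ ≤ B / (1 + t) := by
  obtain ⟨K, hK, hle⟩ := H.exists_norm_logIntegrand_ray_le hZ hC hκ ⟨hα.1.le, hαγ⟩ hnodal
  have hsin : 0 < Real.sin α := Real.sin_pos_of_mem_Ioo hα
  exact ⟨K * (1 / κ + 1 / Real.sin α + 2 / κ), by positivity, fun A hA t ht =>
    integral_norm_le_div_one_add hK hκ hsin ht (hle A hA t ht)⟩

theorem exists_norm_logIntegrand_le (hZ : ∀ a ∈ Z, 0 < a.im) {α γ C κ : ℝ} (hC : 0 ≤ C)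
    (hκ : 0 < κ) (hα : α ∈ Set.Icc 0 Real.pi) (hαγ : α ≤ γ)
    (hnodal : ∃ c, 0 < c ∧ ∀ x : ℝ, c ≤ ‖nodal Z m (exp (x + α * I))‖) :
    ∃ K, 0 ≤ K ∧ ∀ A, DecaysInSector A γ C κ → ∀ t : ℝ, 0 ≤ t → ∀ x : ℝ,
      ‖H.logIntegrand A t (x + α * I)‖ ≤
        K * (Real.exp x * Real.exp (-(κ / 2) * Real.exp x)) := by
  obtain ⟨K, hK, hle⟩ := H.exists_norm_logIntegrand_ray_le hZ hC hκ ⟨hα.1, hαγ⟩ hnodal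
  refine ⟨2 * K, by positivity, fun A hA t ht x => (hle A hA t ht x).trans ?_⟩
  have hκt : κ / 2 ≤ κ + t * Real.sin α := by
    linarith [mul_nonneg ht (Real.sin_nonneg_of_mem_Icc hα)]
  calc _ ≤ K * (Real.exp x * Real.exp (-(κ / 2) * Real.exp x) +
        1 * (Real.exp x * Real.exp (-(κ / 2) * Real.exp x))) := by
        gcongr
        exact div_le_one_of_le₀ (by linarith) (by linarith)
    _ = _ := by ring

end ExpInterpolation

theorem DecaysInSector.integrable_div_nodal {Z : Finset ℂ} {m : ℕ} {A : ℂ → ℂ} {α C κ : ℝ}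
    (hA : DecaysInSector A α C κ) (hα : 0 < α) (hα' : α ≤ Real.pi) (hκ : 0 < κ)
    (hnodal : ∃ c, 0 < c ∧ ∀ x : ℝ, c ≤ ‖nodal Z m (exp x)‖) (p : Polynomial ℂ) :
    Integrable fun x : ℝ => A (exp x) / nodal Z m (exp x) * exp x * p.eval (exp x) := by
  obtain ⟨c, hc, hnodal⟩ := hnodal
  obtain ⟨D, -, hD⟩ := exists_norm_polynomial_eval_le p (half_pos hκ)
  have hint : Integrable fun x : ℝ => A (exp x) * p.eval (exp x) * exp x := by
    simpa using (hA.decaysInStrip hα.le hα' hκ p.differentiable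
      fun w _ => hD w).integrable_line hα (Set.left_mem_Icc.2 hα.le)
  have hinv : Continuous fun x : ℝ => (nodal Z m (exp x))⁻¹ :=
    ((continuous_nodal Z m).comp (by fun_prop)).inv₀ fun x =>
      norm_pos_iff.1 (hc.trans_le (hnodal x))
  refine (hint.bdd_mul (c := c⁻¹) hinv.aestronglyMeasurable
    (Eventually.of_forall fun x => ?_)).congr (Eventually.of_forall fun x => ?_)
  · rw [norm_inv]
    exact inv_anti₀ hc (hnodal x)
  · simp only [div_eq_mul_inv]
    ring

/-- The nodes, in the coordinate `u` with `ω = exp u`, of the quadrature rule with step `h` and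
`N₁ + N₂` points on the ray `arg ω = a`. -/
noncomputable def quadNode (a h : ℝ) (N₁ i : ℕ) : ℂ := ((i - N₁) * h : ℝ) + a * I

/-- The error of the trapezoidal rule with step `h` and `N₁ + N₂` nodes on the line `Im u = a`, as
an approximation to the integral of `f` over the real line. -/
noncomputable def quadError (a h : ℝ) (N₁ N₂ : ℕ) (f : ℂ → ℂ) : ℂ :=
  (∫ x : ℝ, f x) - h * ∑ i ∈ Finset.range (N₁ + N₂), f (quadNode a h N₁ i)

theorem quadError_eq_add_sum {ι : Type*} (s : Finset ι) {a h : ℝ} {N₁ N₂ : ℕ} {f g : ℂ → ℂ}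
    {φ : ι → ℂ → ℂ} {c : ι → ℂ} (hf : Integrable fun x : ℝ => f x)
    (hφ : ∀ i ∈ s, Integrable fun x : ℝ => φ i x)
    (hreal : ∀ x : ℝ, g x = f x + ∑ i ∈ s, c i * φ i x)
    (hline : ∀ x : ℝ, g (x + a * I) = f (x + a * I) + ∑ i ∈ s, c i * φ i (x + a * I)) :
    quadError a h N₁ N₂ g =
      quadError a h N₁ N₂ f + ∑ i ∈ s, c i * quadError a h N₁ N₂ (φ i) := by
  have hint : ∫ x : ℝ, g x = (∫ x : ℝ, f x) + ∑ i ∈ s, c i * ∫ x : ℝ, φ i x := by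
    simp_rw [hreal]
    rw [integral_add hf (integrable_finsetSum _ fun i hi => (hφ i hi).const_mul _),
      integral_finsetSum _ fun i hi => (hφ i hi).const_mul _]
    simp_rw [integral_const_mul]
  have hsum : ∑ j ∈ Finset.range (N₁ + N₂), g (quadNode a h N₁ j) =
      ∑ j ∈ Finset.range (N₁ + N₂), f (quadNode a h N₁ j) +
        ∑ i ∈ s, c i * ∑ j ∈ Finset.range (N₁ + N₂), φ i (quadNode a h N₁ j) := by
    simp_rw [quadNode, hline, Finset.sum_add_distrib, Finset.mul_sum]
    rw [Finset.sum_comm (s := s)]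
  simp only [quadError, hint, hsum, mul_sub, Finset.sum_sub_distrib, mul_add, Finset.mul_sum]
  simp only [mul_left_comm (h : ℂ)]
  ring

theorem integral_Ioi_eq_integral_exp_mul (g : ℝ → ℂ) :
    ∫ x in Set.Ioi 0, g x = ∫ x : ℝ, Real.exp x * g (Real.exp x) := by
  have hsubst := integral_image_eq_integral_abs_deriv_smul (s := Set.univ) (f := Real.exp)
    MeasurableSet.univ (fun x _ => (Real.hasDerivAt_exp x).hasDerivWithinAt)
    Real.exp_injective.injOn g
  rw [Set.image_univ, Real.range_exp, Measure.restrict_univ] at hsubst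
  simp [hsubst, real_smul]

/-- For all admissible steps `h` and all node numbers `N₁`, `N₂`, the function `Δ` is approximated
on `[0, ∞)` by limits of `N₁ + N₂ + M` exponentials, with the error of a trapezoidal rule in a
strip of half-width `d`: the discretization error decays in `t`, and the two truncation errors
come from the ends `0` and `∞` of the frequency axis. -/
def HasExpQuadrature (Δ : ℝ → ℂ) (d κ K : ℝ) (M : ℕ) : Prop :=
  ∀ h : ℝ, 0 < h → h ≤ 1 → 2 ≤ Real.exp (2 * Real.pi * d / h) → ∀ N₁ N₂ : ℕ,
    ∃ g : ℝ → ℂ, (∀ T, IsExpSumLimit T (N₁ + N₂ + M) g) ∧ ∀ t : ℝ, 0 ≤ t →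
      ‖Δ t - g t‖ ≤ K * (Real.exp (-(2 * Real.pi * d / h)) / (1 + t) +
        Real.exp (-(N₁ * h)) + Real.exp (-κ * Real.exp (N₂ * h)))

theorem two_mul_div_sub_one_le {b q : ℝ} (hb : 0 ≤ b) (hq : 2 ≤ q) :
    2 * b / (q - 1) ≤ 4 * b * q⁻¹ := by
  rw [← div_eq_mul_inv, div_le_div_iff₀ (by linarith) (by linarith)]
  nlinarith [mul_le_mul_of_nonneg_left hq hb]

namespace ExpInterpolation

variable {Z : Finset ℂ} {m : ℕ} (H : ExpInterpolation Z m)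

theorem quadError_exp_eq {A : ℂ → ℂ} {α a C κ : ℝ} (hA : DecaysInSector A α C κ) (hα : 0 < α)
    (hα' : α ≤ Real.pi) (hκ : 0 < κ)
    (hreal : ∃ c, 0 < c ∧ ∀ x : ℝ, c ≤ ‖nodal Z m (exp x)‖)
    (hline : ∀ x : ℝ, nodal Z m (exp (x + a * I)) ≠ 0) {t : ℝ} (ht : 0 ≤ t) (h : ℝ) (N₁ N₂ : ℕ) :
    quadError a h N₁ N₂ (fun u => A (exp u) / nodal Z m (exp u) * exp u * exp (I * exp u * t)) =
      quadError a h N₁ N₂ (H.logIntegrand A t) + ∑ i ∈ Z ×ˢ Finset.range m,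
        (t : ℂ) ^ i.2 * exp (I * i.1 * t) * quadError a h N₁ N₂
          (fun u => A (exp u) / nodal Z m (exp u) * exp u * (H.coeff i).eval (exp u)) := by
  have hne : ∀ x : ℝ, nodal Z m (exp x) ≠ 0 := fun x =>
    hreal.elim fun c hc => norm_pos_iff.1 (hc.1.trans_le (hc.2 x))
  have hdecomp : ∀ u : ℂ, nodal Z m (exp u) ≠ 0 →
      A (exp u) / nodal Z m (exp u) * exp u * exp (I * exp u * t) = H.logIntegrand A t u +
        ∑ i ∈ Z ×ˢ Finset.range m, (t : ℂ) ^ i.2 * exp (I * i.1 * t) *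
          (A (exp u) / nodal Z m (exp u) * exp u * (H.coeff i).eval (exp u)) := by
    intro u hu
    rw [H.logIntegrand_eq A t hu, mul_sub, interpolant, Finset.mul_sum, sub_add_eq_add_sub,
      eq_sub_iff_add_eq, add_right_inj]
    exact Finset.sum_congr rfl fun i _ => by ring
  refine quadError_eq_add_sum _ ?_ (fun i _ => ?_) (fun x => hdecomp x (hne x))
    fun x => hdecomp _ (hline x)
  · simpa using (H.decaysInStrip_logIntegrand hA hα.le hα' hκ ht).integrable_line hα
      (Set.left_mem_Icc.2 hα.le)
  · exact hA.integrable_div_nodal hα hα' hκ hreal (H.coeff i)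

theorem exists_norm_quadError_logIntegrand_le {θ d C κ : ℝ} (hθ : 0 < θ) (hd : 0 < d)
    (hθd : θ + 2 * d < Real.pi) (hκ : 0 < κ) (hC : 0 ≤ C) (hZ : ∀ a ∈ Z,
      a.arg ∈ Set.Ioo 0 Real.pi ∧ a.arg ≠ θ ∧ a.arg ≠ θ + d ∧ a.arg ≠ θ + 2 * d) :
    ∃ K, 0 ≤ K ∧ ∀ A, DecaysInSector A (θ + 2 * d) C κ → ∀ h : ℝ, 0 < h → h ≤ 1 →
      2 ≤ Real.exp (2 * Real.pi * d / h) → ∀ (N₁ N₂ : ℕ) (t : ℝ), 0 ≤ t →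
      ‖quadError (θ + d) h N₁ N₂ (H.logIntegrand A t)‖ ≤
        K * (Real.exp (-(2 * Real.pi * d / h)) / (1 + t) + Real.exp (-(N₁ * h)) +
          Real.exp (-(κ / 4) * Real.exp (N₂ * h))) := by
  have hZim : ∀ a ∈ Z, 0 < a.im := fun a ha => im_pos_of_arg_mem (hZ a ha).1
  obtain ⟨B, hB, hBle⟩ := H.exists_integral_norm_logIntegrand_le hZim (γ := θ + 2 * d) hC hκ
    (α := θ) ⟨hθ, by linarith⟩ (by linarith)
    (exists_le_norm_nodal_exp Z m ⟨hθ.le, by linarith⟩ fun a ha => ⟨(hZ a ha).1, (hZ a ha).2.1⟩)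
  obtain ⟨B', hB', hBle'⟩ := H.exists_integral_norm_logIntegrand_le hZim hC hκ
    (α := θ + 2 * d) ⟨by linarith, hθd⟩ le_rfl
    (exists_le_norm_nodal_exp Z m ⟨by linarith, hθd⟩ fun a ha => ⟨(hZ a ha).1, (hZ a ha).2.2.2⟩)
  obtain ⟨K, hK, hKle⟩ := H.exists_norm_logIntegrand_le hZim (γ := θ + 2 * d) hC hκ
    (α := θ + d) ⟨by linarith, by linarith⟩ (by linarith)
    (exists_le_norm_nodal_exp Z m ⟨by linarith, by linarith⟩
      fun a ha => ⟨(hZ a ha).1, (hZ a ha).2.2.1⟩)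
  refine ⟨4 * (B + B') + K * (2 + 16 / (κ / 2) ^ 2), by positivity,
    fun A hA h hh hh' hexp N₁ N₂ t ht => ?_⟩
  have hf := H.decaysInStrip_logIntegrand hA (by linarith) hθd.le hκ ht
  have hshift := hf.integral_line_eq (by linarith) (y := 0) (y' := θ + d)
    ⟨le_rfl, by linarith⟩ ⟨by linarith, by linarith⟩
  simp only [ofReal_zero, zero_mul, add_zero] at hshift
  have htrap := (hf.mono (a' := θ + d - d) (b' := θ + d + d) (by linarith)
      (by linarith)).norm_trapezoid_range_sub_integral_le hd hh hh'
    (B := (B + B') / (1 + t)) ?_ ?_ (half_pos hκ) hK (hKle A hA t ht) N₁ N₂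
  · rw [quadError, hshift, norm_sub_rev]
    refine htrap.trans ?_
    refine (add_le_add_left (two_mul_div_sub_one_le (b := (B + B') / (1 + t))
      (by positivity) hexp) _).trans ?_
    rw [← Real.exp_neg, show κ / 2 / 2 = κ / 4 by ring]
    set E := Real.exp (-(2 * Real.pi * d / h))
    set R := Real.exp (-(N₁ * h)) + Real.exp (-(κ / 4) * Real.exp (N₂ * h))
    have hcross : 0 ≤ 4 * (B + B') * R + K * (2 + 16 / (κ / 2) ^ 2) * (E / (1 + t)) := by
      positivity
    linear_combination hcross
  · rw [add_sub_cancel_right]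
    refine (hBle A hA t ht).trans ?_
    gcongr
    linarith
  · rw [add_assoc θ, ← two_mul]
    refine (hBle' A hA t ht).trans ?_
    gcongr
    linarith

end ExpInterpolation

theorem HasExpQuadrature.const_mul {Δ : ℝ → ℂ} {d κ K : ℝ} {M : ℕ}
    (hΔ : HasExpQuadrature Δ d κ K M) (c : ℂ) :
    HasExpQuadrature (fun t => c * Δ t) d κ (‖c‖ * K) M := by
  intro h hh hh' hexp N₁ N₂
  obtain ⟨g, hg, hle⟩ := hΔ h hh hh' hexp N₁ N₂
  refine ⟨fun t => c * g t, fun T => (hg T).const_mul c, fun t ht => ?_⟩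
  rw [← mul_sub, norm_mul, mul_assoc]
  gcongr
  exact hle t ht

theorem isExpSum_sum_quadNode {a : ℝ} (ha : a ∈ Set.Icc 0 Real.pi) (h : ℝ) (N₁ N₂ : ℕ)
    (f : ℂ → ℂ) : IsExpSum (N₁ + N₂) fun t =>
      h * ∑ i ∈ Finset.range (N₁ + N₂),
        f (quadNode a h N₁ i) * exp (I * exp (quadNode a h N₁ i) * t) := by
  refine IsExpSum.const_mul ?_ _
  have hsum := IsExpSum.sum (Finset.range (N₁ + N₂)) (N := fun _ => 1) fun i _ =>
    IsExpSum.exp_mul (f (quadNode a h N₁ i)) (im_exp_nonneg (u := quadNode a h N₁ i) (by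
      simpa [quadNode] using ha))
  simpa using hsum

theorem integral_Ioi_eq_quadError_add (g : ℂ → ℂ) (a h : ℝ) (N₁ N₂ : ℕ) (t : ℝ) :
    ∫ x : ℝ in Set.Ioi 0, g x * exp (I * x * t) =
      quadError a h N₁ N₂ (fun u => g (exp u) * exp u * exp (I * exp u * t)) +
        h * ∑ i ∈ Finset.range (N₁ + N₂), g (exp (quadNode a h N₁ i)) *
          exp (quadNode a h N₁ i) * exp (I * exp (quadNode a h N₁ i) * t) := by
  rw [integral_Ioi_eq_integral_exp_mul, quadError, sub_add_cancel]
  refine integral_congr_ae (Eventually.of_forall fun x => ?_)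
  simp only [ofReal_exp]
  ring

theorem exists_hasExpQuadrature (Z : Finset ℂ) (m : ℕ) {θ d C κ : ℝ} (hθ : 0 < θ) (hd : 0 < d)
    (hθd : θ + 2 * d < Real.pi) (hκ : 0 < κ) (hC : 0 ≤ C) (hZ : ∀ a ∈ Z,
      a.arg ∈ Set.Ioo 0 Real.pi ∧ a.arg ≠ θ ∧ a.arg ≠ θ + d ∧ a.arg ≠ θ + 2 * d) :
    ∃ K M, 0 ≤ K ∧ ∀ A, DecaysInSector A (θ + 2 * d) C κ → HasExpQuadrature
      (fun t => ∫ x : ℝ in Set.Ioi 0, A x / nodal Z m x * exp (I * x * t)) d (κ / 4) K M := by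
  obtain ⟨H⟩ : Nonempty (ExpInterpolation Z m) := inferInstance
  obtain ⟨K, hK, hle⟩ := H.exists_norm_quadError_logIntegrand_le hθ hd hθd hκ hC hZ
  refine ⟨K, ∑ i ∈ Z ×ˢ Finset.range m, 2 ^ i.2, hK, fun A hA h hh hh' hexp N₁ N₂ => ?_⟩
  have hreal : ∃ c, 0 < c ∧ ∀ x : ℝ, c ≤ ‖nodal Z m (exp x)‖ := by
    simpa using exists_le_norm_nodal_exp Z m ⟨le_rfl, Real.pi_pos⟩ fun a ha =>
      ⟨(hZ a ha).1, (hZ a ha).1.1.ne'⟩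
  have hline : ∀ x : ℝ, nodal Z m (exp (x + (θ + d : ℝ) * I)) ≠ 0 := by
    obtain ⟨c, hc, hle⟩ := exists_le_norm_nodal_exp Z m (θ := θ + d)
      ⟨by linarith, by linarith⟩ fun a ha => ⟨(hZ a ha).1, (hZ a ha).2.2.1⟩
    exact fun x => norm_pos_iff.1 (hc.trans_le (hle x))
  refine ⟨_, fun T => (IsExpSumLimit.of_isExpSum (isExpSum_sum_quadNode (a := θ + d)
    ⟨by linarith, by linarith⟩ h N₁ N₂ fun u => A (exp u) / nodal Z m (exp u) * exp u)).add
      (IsExpSumLimit.sum _ fun i hi => (IsExpSumLimit.pow_mul_exp T i.2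
        (im_pos_of_arg_mem (hZ i.1 (Finset.mem_product.1 hi).1).1).le).const_mul
          (quadError (θ + d) h N₁ N₂ fun u =>
            A (exp u) / nodal Z m (exp u) * exp u * (H.coeff i).eval (exp u))),
    fun t ht => le_of_eq_of_le (congrArg _ ?_) (hle A hA h hh hh' hexp N₁ N₂ t ht)⟩
  beta_reduce
  rw [integral_Ioi_eq_quadError_add (fun w => A w / nodal Z m w) (θ + d) h N₁ N₂,
    H.quadError_exp_eq hA (by linarith) hθd.le hκ hreal hline ht]
  simp only [mul_comm (quadError _ _ _ _ _)]
  ring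

theorem exists_le_norm_exp_add_one {τ : ℝ} (hτ : 0 < τ) :
    ∃ B, 0 < B ∧ ∀ z : ℂ, |z.im| ≤ τ * |z.re| → B ≤ ‖exp z + 1‖ := by
  set x₀ := Real.pi / (2 * τ) with hx₀
  have hx₀_pos : 0 < x₀ := by positivity
  refine ⟨1 - Real.exp (-x₀), by simpa using hx₀_pos, fun z hz => ?_⟩
  by_cases hy : |z.im| ≤ Real.pi / 2
  · have hcos : 0 ≤ Real.cos z.im := Real.cos_nonneg_of_mem_Icc (abs_le.1 hy)
    have hre : 1 ≤ (exp z + 1).re := by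
      rw [add_re, exp_re, one_re]
      exact le_add_of_nonneg_left (mul_nonneg (Real.exp_pos z.re).le hcos)
    linarith [re_le_norm (exp z + 1), Real.exp_pos (-x₀)]
  · have hx : x₀ ≤ |z.re| := by
      rw [hx₀, div_le_iff₀ (by positivity)]
      linarith
    have hnorm : |Real.exp z.re - 1| ≤ ‖exp z + 1‖ := by
      simpa [norm_exp] using abs_norm_sub_norm_le (exp z) (-1)
    refine le_trans ?_ hnorm
    rcases le_abs'.1 hx with hneg | hpos
    · rw [abs_sub_comm]
      exact (sub_le_sub_left (Real.exp_le_exp.2 hneg) 1).trans (le_abs_self _)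
    · linarith [le_abs_self (Real.exp z.re - 1), Real.add_one_le_exp (-x₀),
        Real.add_one_le_exp z.re]

theorem Species.exists_norm_occupation_le {τ : ℝ} (hτ : 0 < τ) :
    ∃ B, 0 < B ∧ ∀ (s : Species) (β : ℝ) (ω : ℂ), |ω.im| ≤ τ * |ω.re| →
      exp (β * ω) + 1 ≠ 0 ∧ ‖s.occupation β ω‖ ≤ B := by
  obtain ⟨b, hb, hle⟩ := exists_le_norm_exp_add_one hτ
  refine ⟨1 + 1 / b, by positivity, fun s β ω hω => ?_⟩
  have hden : b ≤ ‖exp (β * ω) + 1‖ := by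
    refine hle _ ?_
    rw [re_ofReal_mul, im_ofReal_mul, abs_mul, abs_mul, mul_left_comm]
    gcongr
  have hfermi : ‖fermi β ω‖ ≤ 1 / b := by
    rw [fermi, norm_div, norm_one]
    exact one_div_le_one_div_of_le hb hden
  refine ⟨norm_pos_iff.1 (hb.trans_le hden), ?_⟩
  cases s with
  | particle => exact (norm_sub_le _ _).trans (by simpa using hfermi)
  | hole => exact hfermi.trans (by simp)

theorem Species.differentiableAt_occupation (s : Species) {β : ℝ} {ω : ℂ}
    (h : exp (β * ω) + 1 ≠ 0) : DifferentiableAt ℂ (s.occupation β) ω := by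
  have hfermi : DifferentiableAt ℂ (fermi β) ω := by
    unfold fermi
    exact (differentiableAt_const _).div (by fun_prop) h
  cases s with
  | particle => exact (differentiableAt_const _).sub hfermi
  | hole => exact hfermi

theorem arg_exp {u : ℂ} (hu : u.im ∈ Set.Ioc (-Real.pi) Real.pi) : (exp u).arg = u.im := by
  rw [← log_im, log_exp hu.1 hu.2]

theorem abs_im_exp_le {α : ℝ} (hα : α < Real.pi / 2) {u : ℂ} (hu : u.im ∈ Set.Icc 0 α) :
    |(exp u).im| ≤ Real.tan α * |(exp u).re| := by
  have hcos : ∀ x ∈ Set.Icc 0 α, 0 < Real.cos x := fun x hx =>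
    Real.cos_pos_of_mem_Ioo ⟨by linarith [hx.1, Real.pi_pos], by linarith [hx.2]⟩
  have hsin : 0 ≤ Real.sin u.im :=
    Real.sin_nonneg_of_mem_Icc ⟨hu.1, by linarith [hu.2, Real.pi_pos]⟩
  have htan : Real.tan u.im ≤ Real.tan α := by
    refine Real.strictMonoOn_tan.monotoneOn ⟨?_, ?_⟩ ⟨?_, hα⟩ hu.2 <;>
      linarith [hu.1, hu.2, Real.pi_pos]
  rw [exp_im, exp_re, abs_of_nonneg (mul_nonneg (Real.exp_pos _).le hsin),
    abs_of_pos (mul_pos (Real.exp_pos _) (hcos _ hu)), mul_left_comm]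
  refine mul_le_mul_of_nonneg_left ?_ (Real.exp_pos _).le
  rwa [← div_le_iff₀ (hcos _ hu), ← Real.tan_eq_sin_div_cos]

theorem analyticAt_nodal (Z : Finset ℂ) (m : ℕ) (z : ℂ) : AnalyticAt ℂ (nodal Z m) z :=
  Finset.analyticAt_fun_prod _ fun a _ => by fun_prop

theorem exists_norm_nodal_le (Z : Finset ℂ) (m : ℕ) {κ : ℝ} (hκ : 0 < κ) :
    ∃ D, 0 ≤ D ∧ ∀ w, ‖nodal Z m w‖ ≤ D * Real.exp (κ * ‖w‖) := by
  obtain ⟨D, hD, hle⟩ :=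
    exists_norm_polynomial_eval_le (∏ a ∈ Z, (Polynomial.X - Polynomial.C a) ^ m) hκ
  exact ⟨D, hD, fun w => by simpa [Polynomial.eval_prod, nodal] using hle w⟩

theorem exists_meromorphicOrderAt_nodal_mul_nonneg {f : ℂ → ℂ} {U : Set ℂ}
    (hf : MeromorphicOn f U) (Z : Finset ℂ) (hZ : ∀ z ∈ U, meromorphicOrderAt f z < 0 → z ∈ Z) :
    ∃ m, ∀ z ∈ U, 0 ≤ meromorphicOrderAt (fun w => nodal Z m w * f w) z := by
  choose! n hn using hf
  refine ⟨Z.sup n, fun z hz => ?_⟩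
  by_cases hzZ : z ∈ Z
  · have hle : n z ≤ Z.sup n := Finset.le_sup hzZ
    have hfactor : (fun w => nodal Z (Z.sup n) w * f w) = fun w =>
        nodal (Z.erase z) (Z.sup n) w * (w - z) ^ (Z.sup n - n z) * ((w - z) ^ n z • f w) := by
      ext w
      rw [nodal, ← Finset.mul_prod_erase Z _ hzZ, nodal, smul_eq_mul]
      nth_rewrite 1 [← Nat.sub_add_cancel hle]
      rw [pow_add]
      ring
    rw [hfactor]
    exact (((analyticAt_nodal _ _ z).mul (by fun_prop)).mul (hn z hz)).meromorphicOrderAt_nonneg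
  · have hnonneg : 0 ≤ meromorphicOrderAt f z := not_lt.1 fun h => hzZ (hZ z hz h)
    exact (add_nonneg (analyticAt_nodal Z _ z).meromorphicOrderAt_nonneg hnonneg).trans_eq
      (meromorphicOrderAt_mul (analyticAt_nodal Z _ z).meromorphicAt ⟨n z, hn z hz⟩).symm

section NormalForm

variable {P : ℂ → ℂ} {U : Set ℂ} {z : ℂ}

theorem analyticAt_toMeromorphicNFOn (hP : MeromorphicOn P U) (hz : z ∈ U)
    (h : 0 ≤ meromorphicOrderAt P z) : AnalyticAt ℂ (toMeromorphicNFOn P U) z := by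
  rwa [← (meromorphicNFOn_toMeromorphicNFOn P U hz).meromorphicOrderAt_nonneg_iff_analyticAt,
    meromorphicOrderAt_toMeromorphicNFOn hP hz]

theorem tendsto_nhdsNE_toMeromorphicNFOn (hP : MeromorphicOn P U) (hz : z ∈ U)
    (h : 0 ≤ meromorphicOrderAt P z) : Tendsto P (𝓝[≠] z) (𝓝 (toMeromorphicNFOn P U z)) :=
  ((analyticAt_toMeromorphicNFOn hP hz h).continuousAt.tendsto.mono_left
    nhdsWithin_le_nhds).congr' (hP.toMeromorphicNFOn_eq_self_on_nhdsNE hz)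

theorem norm_toMeromorphicNFOn_le {g : ℂ → ℝ} (hP : MeromorphicOn P U) (hz : z ∈ U)
    (h : 0 ≤ meromorphicOrderAt P z) (hg : ContinuousAt g z) (hle : ∀ᶠ w in 𝓝 z, ‖P w‖ ≤ g w) :
    ‖toMeromorphicNFOn P U z‖ ≤ g z :=
  le_of_tendsto_of_tendsto (tendsto_nhdsNE_toMeromorphicNFOn hP hz h).norm
    (hg.tendsto.mono_left nhdsWithin_le_nhds) (hle.filter_mono nhdsWithin_le_nhds)

theorem continuousWithinAt_toMeromorphicNFOn {S : Set ℂ} (hP : MeromorphicOn P U) (hU : IsOpen U)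
    (hSU : S ⊆ U) (hS : ∀ w ∈ S, 0 ≤ meromorphicOrderAt P w) {V : Set ℂ} (hUV : U ⊆ V)
    (hz : z ∈ V \ U) (hcont : ContinuousWithinAt P V z) :
    ContinuousWithinAt (toMeromorphicNFOn P U) (S ∪ V \ U) z := by
  have hcompl : ∀ w ∈ V \ U, toMeromorphicNFOn P U w = P w := fun w hw =>
    toMeromorphicNFOn_eq_self_on_compl hP hw.2
  rw [Metric.continuousWithinAt_iff] at hcont ⊢
  intro ε hε
  obtain ⟨δ, hδ, hclose⟩ := hcont (ε / 2) (half_pos hε)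
  refine ⟨δ, hδ, fun {w} hw hwz => ?_⟩
  rw [hcompl z hz]
  rcases hw with hw | hw
  · refine lt_of_le_of_lt ?_ (half_lt_self hε)
    refine Metric.isClosed_closedBall.mem_of_tendsto
      (tendsto_nhdsNE_toMeromorphicNFOn hP (hSU hw) (hS w hw))
      (Eventually.filter_mono nhdsWithin_le_nhds ?_)
    filter_upwards [hU.mem_nhds (hSU hw), Metric.isOpen_ball.mem_nhds (Metric.mem_ball.2 hwz)]
      with v hvU hvz
    exact (hclose (hUV hvU) hvz).le
  · rw [hcompl w hw]
    exact (hclose hw.1 hwz).trans (half_lt_self hε)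

end NormalForm

/-- The product of `Γ` and the nodal polynomial, with its removable singularities in the upper
half-plane removed. -/
noncomputable def clearPoles (Z : Finset ℂ) (m : ℕ) (Γ : ℂ → ℂ) : ℂ → ℂ :=
  toMeromorphicNFOn (fun w => nodal Z m w * Γ w) {ω | 0 < ω.im}

theorem meromorphicOn_nodal_mul (Z : Finset ℂ) (m : ℕ) {Γ : ℂ → ℂ} {U : Set ℂ}
    (hΓ : MeromorphicOn Γ U) : MeromorphicOn (fun w => nodal Z m w * Γ w) U := fun z hz =>
  (analyticAt_nodal Z m z).meromorphicAt.mul (hΓ z hz)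

theorem clearPoles_ofReal {Γ : ℂ → ℂ} (hΓ : MeromorphicOn Γ {ω | 0 < ω.im}) (Z : Finset ℂ)
    (m : ℕ) (x : ℝ) : clearPoles Z m Γ x = nodal Z m x * Γ x :=
  toMeromorphicNFOn_eq_self_on_compl (meromorphicOn_nodal_mul Z m hΓ) (by simp)

theorem DecaysInSector.of_norm_le_interior {A : ℂ → ℂ} {α C κ : ℝ} (hα : 0 < α)
    (hA : DiffContOnCl ℂ (fun u => A (exp u)) (im ⁻¹' Set.Ioo 0 α))
    (hle : ∀ u : ℂ, u.im ∈ Set.Ioo 0 α → ‖A (exp u)‖ ≤ C * Real.exp (-κ * Real.exp u.re)) :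
    DecaysInSector A α C κ := by
  refine ⟨hA, fun u hu => ?_⟩
  have hclosure : closure (im ⁻¹' Set.Ioo 0 α) = im ⁻¹' Set.Icc 0 α := by
    rw [closure_preimage_im, closure_Ioo hα.ne]
  refine le_on_closure (fun v hv => hle v hv) hA.continuousOn.norm ?_ (hclosure ▸ hu)
  fun_prop

theorem exists_decaysInSector {A : ℂ → ℂ} {α C κ x₁ x₂ : ℝ} (hα : 0 < α) (hκ : 0 ≤ κ)
    (hA : DiffContOnCl ℂ (fun u => A (exp u)) (im ⁻¹' Set.Ioo 0 α))
    (hle : ∀ u : ℂ, u.im ∈ Set.Ioo 0 α → (u.re < x₁ ∨ x₂ < u.re) →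
      ‖A (exp u)‖ ≤ C * Real.exp (-κ * Real.exp u.re)) :
    ∃ C', 0 ≤ C' ∧ DecaysInSector A α C' κ := by
  have hcont : ContinuousOn (fun u => A (exp u)) (im ⁻¹' Set.Icc 0 α) := by
    simpa only [closure_preimage_im, closure_Ioo hα.ne] using hA.continuousOn
  obtain ⟨M, hM⟩ := (isCompact_Icc.reProdIm isCompact_Icc :
    IsCompact (Set.Icc x₁ x₂ ×ℂ Set.Icc 0 α)).exists_bound_of_continuousOn
      (hcont.mono fun u hu => hu.2)
  refine ⟨|C| + |M| * Real.exp (κ * Real.exp x₂), by positivity,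
    .of_norm_le_interior hα hA fun u hu => ?_⟩
  rw [add_mul]
  by_cases hre : u.re < x₁ ∨ x₂ < u.re
  · refine (hle u hu hre).trans (le_add_of_le_of_nonneg ?_ (by positivity))
    gcongr
    exact le_abs_self C
  · push Not at hre
    refine le_add_of_nonneg_of_le (by positivity) ?_
    rw [mul_assoc, ← Real.exp_add]
    refine (hM u ⟨hre, Set.Ioo_subset_Icc_self hu⟩).trans ((le_abs_self M).trans ?_)
    refine le_mul_of_one_le_right (abs_nonneg M) (Real.one_le_exp ?_)
    linarith [mul_le_mul_of_nonneg_left (Real.exp_le_exp.2 hre.2) hκ]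

theorem im_pos_of_mem_sector_pos {α : ℝ} (hα : α ≤ Real.pi) {z : ℂ}
    (hz : z ∈ FreqSign.pos.sector α) : 0 < z.im :=
  im_pos_of_arg_mem ⟨hz.1, hz.2.trans_le hα⟩

theorem exp_mem_sector_pos {α : ℝ} (hα : α ≤ Real.pi) {u : ℂ} (hu : u.im ∈ Set.Ioo 0 α) :
    exp u ∈ FreqSign.pos.sector α := by
  have harg : (exp u).arg = u.im :=
    arg_exp ⟨by linarith [hu.1, Real.pi_pos], by linarith [hu.2]⟩
  exact ⟨harg ▸ hu.1, harg ▸ hu.2⟩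

theorem sector_pos_mem_nhds {α : ℝ} (hα : α ≤ Real.pi) {z : ℂ} (hz : z ∈ FreqSign.pos.sector α) :
    FreqSign.pos.sector α ∈ 𝓝 z :=
  (continuousAt_arg (Or.inr (im_pos_of_mem_sector_pos hα hz).ne')).preimage_mem_nhds
    (Ioo_mem_nhds hz.1 hz.2)

namespace IsAdmissible

variable {Γ : ℂ → ℂ} {rmax : ℝ} {Z : Finset ℂ} {m : ℕ}

theorem exists_order_nodal_mul_nonneg {b : FreqSign} (hΓ : IsAdmissible Γ b rmax)
    (hsector : ∀ z ∈ b.sector (2 * rmax), 0 < z.im) :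
    ∃ (Z : Finset ℂ) (m : ℕ), (∀ a ∈ Z, a ∈ b.sector (2 * rmax)) ∧ ∀ z ∈ b.sector (2 * rmax),
      0 ≤ meromorphicOrderAt (fun w => nodal Z m w * Γ w) z := by
  obtain ⟨m, hm⟩ := exists_meromorphicOrderAt_nodal_mul_nonneg
    (hΓ.meromorphic.mono_set hsector) hΓ.finite_poles.toFinset
    fun z hz hlt => hΓ.finite_poles.mem_toFinset.2 ⟨hz, hlt⟩
  exact ⟨_, m, fun a ha => (hΓ.finite_poles.mem_toFinset.1 ha).1, hm⟩

theorem continuousWithinAt_clearPoles (hrmax : 2 * rmax ≤ Real.pi) (hΓ : IsAdmissible Γ .pos rmax)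
    (hord : ∀ z ∈ FreqSign.pos.sector (2 * rmax),
      0 ≤ meromorphicOrderAt (fun w => nodal Z m w * Γ w) z) {x : ℝ} (hx : 0 < x) :
    ContinuousWithinAt (clearPoles Z m Γ)
      (FreqSign.pos.sector (2 * rmax) ∪ {ω : ℂ | 0 ≤ ω.im} \ {ω | 0 < ω.im}) x :=
  continuousWithinAt_toMeromorphicNFOn (meromorphicOn_nodal_mul Z m hΓ.meromorphic)
    (isOpen_lt continuous_const continuous_im) (fun _ => im_pos_of_mem_sector_pos hrmax) hord
    (Set.ofPred_subset_ofPred.2 fun _ => le_of_lt) (by simp)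
    ((continuous_nodal Z m).continuousWithinAt.mul (hΓ.boundary x hx))

theorem diffContOnCl_clearPoles {α : ℝ} (hα : α ∈ Set.Ioo 0 (2 * rmax))
    (hrmax : 2 * rmax ≤ Real.pi) (hΓ : IsAdmissible Γ .pos rmax)
    (hord : ∀ z ∈ FreqSign.pos.sector (2 * rmax),
      0 ≤ meromorphicOrderAt (fun w => nodal Z m w * Γ w) z) :
    DiffContOnCl ℂ (fun u => clearPoles Z m Γ (exp u)) (im ⁻¹' Set.Ioo 0 α) := by
  have hmaps : ∀ u : ℂ, u.im ∈ Set.Ioc 0 α → exp u ∈ FreqSign.pos.sector (2 * rmax) :=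
    fun u hu => exp_mem_sector_pos hrmax ⟨hu.1, hu.2.trans_lt hα.2⟩
  have hdiff : ∀ u : ℂ, u.im ∈ Set.Ioc 0 α →
      DifferentiableAt ℂ (fun u => clearPoles Z m Γ (exp u)) u := fun u hu =>
    (analyticAt_toMeromorphicNFOn (meromorphicOn_nodal_mul Z m hΓ.meromorphic)
      (im_pos_of_mem_sector_pos hrmax (hmaps u hu))
      (hord _ (hmaps u hu))).differentiableAt.comp u differentiable_exp.differentiableAt
  refine ⟨fun u hu => (hdiff u ⟨hu.1, hu.2.le⟩).differentiableWithinAt, ?_⟩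
  rw [closure_preimage_im, closure_Ioo hα.1.ne]
  intro u hu
  rcases hu.1.lt_or_eq with hpos | hzero
  · exact (hdiff u ⟨hpos, hu.2⟩).continuousAt.continuousWithinAt
  have hreal : ∀ v : ℂ, 0 = v.im → exp v = Real.exp v.re := fun v hv => by
    rw [ofReal_exp, ← re_add_im v, ← hv]
    simp
  have hcont := hΓ.continuousWithinAt_clearPoles hrmax hord (Real.exp_pos u.re)
  rw [← hreal u hzero] at hcont
  refine hcont.comp continuous_exp.continuousWithinAt fun v hv => ?_
  rcases hv.1.lt_or_eq with hpos | hzero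
  · exact Or.inl (hmaps v ⟨hpos, hv.2⟩)
  · exact Or.inr (by simp [hreal v hzero])

theorem exists_norm_nodal_mul_le_of_lt_norm (hΓ : IsAdmissible Γ .pos rmax) {α : ℝ}
    (hα : α ≤ 2 * rmax) (hα' : α < Real.pi / 2) (Z : Finset ℂ) (m : ℕ) :
    ∃ C κ Λ, 0 < κ ∧ ∀ ω ∈ FreqSign.pos.sector α, Λ < ‖ω‖ →
      ‖nodal Z m ω * Γ ω‖ ≤ C * Real.exp (-κ * ‖ω‖) := by
  obtain ⟨G, ν, Λ, hν, hdecay⟩ := hΓ.decay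
  rcases le_or_gt α 0 with hα₀ | hα₀
  · exact ⟨0, 1, 0, one_pos, fun ω hω => absurd (hω.1.trans hω.2) hα₀.not_gt⟩
  have hcos : 0 < Real.cos α := Real.cos_pos_of_mem_Ioo ⟨by linarith, hα'⟩
  set κ := ν * Real.cos α / 2 with hκ
  obtain ⟨D, hD, hnodal⟩ := exists_norm_nodal_le Z m (κ := κ) (by positivity)
  refine ⟨D * |G|, κ, Λ, by positivity, fun ω hω hΛ => ?_⟩
  have hre : Real.cos α * ‖ω‖ ≤ |ω.re| := by
    rw [← norm_mul_cos_arg ω, mul_comm]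
    refine le_trans ?_ (le_abs_self _)
    gcongr
    exact Real.cos_le_cos_of_nonneg_of_le_pi hω.1.le (by linarith) hω.2.le
  have hΓω : ‖Γ ω‖ ≤ |G| * Real.exp (-(2 * κ) * ‖ω‖) := by
    refine (hdecay ω ⟨hω.1, hω.2.trans_le hα⟩ hΛ).le.trans (mul_le_mul (le_abs_self G)
      (Real.exp_le_exp.2 ?_) (Real.exp_pos _).le (abs_nonneg G))
    rw [hκ]
    linarith [mul_le_mul_of_nonneg_left hre hν.le]
  calc ‖nodal Z m ω * Γ ω‖
      ≤ D * Real.exp (κ * ‖ω‖) * (|G| * Real.exp (-(2 * κ) * ‖ω‖)) := by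
        rw [norm_mul]
        gcongr
        exact hnodal ω
    _ = _ := by
        rw [mul_mul_mul_comm, ← Real.exp_add]
        ring_nf

theorem exists_norm_nodal_mul_le_of_norm_lt (hΓ : IsAdmissible Γ .pos rmax) (Z : Finset ℂ)
    (m : ℕ) {κ : ℝ} (hκ : 0 < κ) :
    ∃ C δ, 0 < δ ∧ ∀ ω ∈ FreqSign.pos.sector (2 * rmax), ‖ω‖ < δ →
      ‖nodal Z m ω * Γ ω‖ ≤ C * Real.exp (-κ * ‖ω‖) := by
  obtain ⟨C, δ, hδ, hbound⟩ := hΓ.bounded_zero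
  obtain ⟨D, hD, hnodal⟩ := exists_norm_nodal_le Z m hκ
  refine ⟨D * |C| * Real.exp (2 * κ * δ), δ, hδ, fun ω hω hωδ => ?_⟩
  calc ‖nodal Z m ω * Γ ω‖ ≤ D * Real.exp (κ * ‖ω‖) * |C| := by
        rw [norm_mul]
        gcongr
        · exact hnodal ω
        · exact (hbound ω hω hωδ).trans (le_abs_self C)
    _ ≤ D * Real.exp (2 * κ * δ + -κ * ‖ω‖) * |C| := by
        gcongr
        linarith [mul_lt_mul_of_pos_left hωδ hκ]
    _ = _ := by
        rw [Real.exp_add]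
        ring

theorem norm_clearPoles_le {α C κ : ℝ} (hα : α ≤ 2 * rmax) (hrmax : 2 * rmax ≤ Real.pi)
    (hΓ : IsAdmissible Γ .pos rmax)
    (hord : ∀ z ∈ FreqSign.pos.sector (2 * rmax),
      0 ≤ meromorphicOrderAt (fun w => nodal Z m w * Γ w) z)
    {V : Set ℂ} (hV : IsOpen V) (hle : ∀ ω ∈ FreqSign.pos.sector α, ω ∈ V →
      ‖nodal Z m ω * Γ ω‖ ≤ C * Real.exp (-κ * ‖ω‖))
    {ω : ℂ} (hω : ω ∈ FreqSign.pos.sector α) (hωV : ω ∈ V) :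
    ‖clearPoles Z m Γ ω‖ ≤ C * Real.exp (-κ * ‖ω‖) := by
  have hω' : ω ∈ FreqSign.pos.sector (2 * rmax) := ⟨hω.1, hω.2.trans_le hα⟩
  refine norm_toMeromorphicNFOn_le (g := fun w => C * Real.exp (-κ * ‖w‖))
    (meromorphicOn_nodal_mul Z m hΓ.meromorphic) (im_pos_of_mem_sector_pos hrmax hω')
    (hord ω hω') (by fun_prop) ?_
  filter_upwards [sector_pos_mem_nhds (hα.trans hrmax) hω, hV.mem_nhds hωV] with w hw hwV
  exact hle w hw hwV

theorem exists_decaysInSector_clearPoles (hrmax : 2 * rmax < Real.pi / 2)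
    (hΓ : IsAdmissible Γ .pos rmax) (hord : ∀ z ∈ FreqSign.pos.sector (2 * rmax),
      0 ≤ meromorphicOrderAt (fun w => nodal Z m w * Γ w) z)
    {α : ℝ} (hα : α ∈ Set.Ioo 0 (2 * rmax)) :
    ∃ C κ, 0 ≤ C ∧ 0 < κ ∧ DecaysInSector (clearPoles Z m Γ) α C κ := by
  have hrmax' : 2 * rmax ≤ Real.pi := by linarith [Real.pi_pos]
  obtain ⟨C, κ, Λ, hκ, htop⟩ :=
    hΓ.exists_norm_nodal_mul_le_of_lt_norm hα.2.le (hα.2.trans hrmax) Z m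
  obtain ⟨C', δ, hδ, hzero⟩ := hΓ.exists_norm_nodal_mul_le_of_norm_lt Z m hκ
  suffices hends : ∀ u : ℂ, u.im ∈ Set.Ioo 0 α →
      (u.re < Real.log δ ∨ Real.log (max Λ 1) < u.re) →
      ‖clearPoles Z m Γ (exp u)‖ ≤ max C C' * Real.exp (-κ * Real.exp u.re) by
    obtain ⟨C'', hC'', hdecays⟩ := exists_decaysInSector hα.1 hκ.le
      (hΓ.diffContOnCl_clearPoles hα hrmax' hord) hends
    exact ⟨C'', κ, hC'', hκ, hdecays⟩
  intro u hu hre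
  have hmem := exp_mem_sector_pos (hα.2.le.trans hrmax') hu
  rw [← norm_exp]
  rcases hre with hsmall | hlarge
  · rw [Real.lt_log_iff_exp_lt hδ, ← norm_exp] at hsmall
    refine (hΓ.norm_clearPoles_le le_rfl hrmax' hord (isOpen_lt continuous_norm continuous_const)
      hzero ⟨hmem.1, hmem.2.trans hα.2⟩ hsmall).trans ?_
    gcongr
    exact le_max_right _ _
  · rw [Real.log_lt_iff_lt_exp (by positivity), ← norm_exp] at hlarge
    refine (hΓ.norm_clearPoles_le hα.2.le hrmax' hord (isOpen_lt continuous_const continuous_norm)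
      htop hmem ((le_max_left _ _).trans_lt hlarge)).trans ?_
    gcongr
    exact le_max_left _ _

end IsAdmissible

theorem DecaysInSector.mul_of_norm_le {A f : ℂ → ℂ} {α C B κ : ℝ} (hα : 0 < α)
    (hA : DecaysInSector A α C κ) (hf : ∀ u : ℂ, u.im ∈ Set.Icc 0 α → DifferentiableAt ℂ f (exp u))
    (hB : ∀ u : ℂ, u.im ∈ Set.Icc 0 α → ‖f (exp u)‖ ≤ B) :
    DecaysInSector (fun w => A w * f w) α (C * B) κ := by
  have hdiff : ∀ u : ℂ, u.im ∈ Set.Icc 0 α → DifferentiableAt ℂ (fun u => f (exp u)) u :=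
    fun u hu => (hf u hu).comp u differentiable_exp.differentiableAt
  refine ⟨hA.diffContOnCl.smul ⟨fun u hu => (hdiff u
    (Set.Ioo_subset_Icc_self hu)).differentiableWithinAt, ?_⟩, fun u hu => ?_⟩
  · rw [closure_preimage_im, closure_Ioo hα.ne]
    exact fun u hu => (hdiff u hu).continuousAt.continuousWithinAt
  · rw [norm_mul, mul_right_comm]
    exact mul_le_mul (hA.norm_le u hu) (hB u hu) (norm_nonneg _)
      ((norm_nonneg _).trans (hA.norm_le u hu))

theorem exists_decaysInSector_mul_occupation {α : ℝ} (hα : α ∈ Set.Ioo 0 (Real.pi / 2)) :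
    ∃ B, 0 < B ∧ ∀ (A : ℂ → ℂ) (C κ : ℝ), DecaysInSector A α C κ → ∀ (s : Species) (β : ℝ),
      DecaysInSector (fun w => A w * s.occupation β w) α (C * B) κ := by
  obtain ⟨B, hB, hocc⟩ :=
    Species.exists_norm_occupation_le (Real.tan_pos_of_pos_of_lt_pi_div_two hα.1 hα.2)
  exact ⟨B, hB, fun A C κ hA s β => hA.mul_of_norm_le hα.1
    (fun u hu => s.differentiableAt_occupation (hocc s β _ (abs_im_exp_le hα.2 hu)).1)
    fun u hu => (hocc s β _ (abs_im_exp_le hα.2 hu)).2⟩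

theorem exists_mem_Ioo_forall_arg_ne (Z : Finset ℂ) {x y : ℝ} (hxy : x < y) (d : ℝ) :
    ∃ θ ∈ Set.Ioo x y, ∀ a ∈ Z, a.arg ≠ θ ∧ a.arg ≠ θ + d ∧ a.arg ≠ θ + 2 * d := by
  classical
  obtain ⟨θ, hθ, hθZ⟩ : ∃ θ ∈ Set.Ioo x y, θ ∉ Z.image arg ∪
      (Z.image fun a => a.arg - d) ∪ Z.image fun a => a.arg - 2 * d :=
    (Set.Ioo_infinite hxy).exists_notMem_finset _
  simp only [Finset.mem_union, Finset.mem_image, not_or, not_exists, not_and] at hθZ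
  exact ⟨θ, hθ, fun a ha => ⟨hθZ.1.1 a ha, fun h => hθZ.1.2 a ha (by linarith),
    fun h => hθZ.2 a ha (by linarith)⟩⟩

theorem exists_norm_kernelIntegrand_le (s : Species) : ∃ B, ∀ (Γ : ℂ → ℂ) (β t x : ℝ),
    ‖kernelIntegrand Γ s β t x‖ ≤ B * ‖Γ x‖ := by
  obtain ⟨B, -, hocc⟩ := Species.exists_norm_occupation_le one_pos
  refine ⟨B / (2 * Real.pi), fun Γ β t x => ?_⟩
  have hexp : ‖exp (I * x * t)‖ = 1 := by simp [norm_exp]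
  have hpi : ‖(2 * Real.pi : ℂ)‖ = 2 * Real.pi := by simp [abs_of_pos Real.pi_pos]
  rw [kernelIntegrand, norm_div, norm_mul, norm_mul, hexp, hpi, mul_one, mul_comm,
    div_mul_eq_mul_div]
  gcongr
  exact (hocc s β x (by simp)).2

theorem Species.continuous_occupation_ofReal (s : Species) (β : ℝ) :
    Continuous fun x : ℝ => s.occupation β x := by
  obtain ⟨_, -, hocc⟩ := Species.exists_norm_occupation_le one_pos
  exact continuous_iff_continuousAt.2 fun x => (s.differentiableAt_occupation
    (hocc s β x (by simp)).1).continuousAt.comp continuous_ofReal.continuousAt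

theorem aestronglyMeasurable_kernelIntegrand {Γ : ℂ → ℂ} {μ : Measure ℝ}
    (hΓ : AEStronglyMeasurable (fun x : ℝ => Γ x) μ) (s : Species) (β t : ℝ) :
    AEStronglyMeasurable (fun x : ℝ => kernelIntegrand Γ s β t x) μ := by
  simp only [kernelIntegrand, div_eq_mul_inv]
  exact ((hΓ.mul (s.continuous_occupation_ofReal β).aestronglyMeasurable).mul
    (by fun_prop)).mul_const _

theorem integrable_kernelIntegrand {Γ : ℂ → ℂ} {μ : Measure ℝ}
    (hΓ : Integrable (fun x : ℝ => Γ x) μ) (s : Species) (β t : ℝ) :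
    Integrable (fun x : ℝ => kernelIntegrand Γ s β t x) μ := by
  obtain ⟨B, hB⟩ := exists_norm_kernelIntegrand_le s
  exact (hΓ.norm.const_mul B).mono' (aestronglyMeasurable_kernelIntegrand
    hΓ.aestronglyMeasurable s β t) (Eventually.of_forall fun x => hB Γ β t x)

theorem continuous_kernel {Γ : ℂ → ℂ} {b : FreqSign}
    (hΓ : IntegrableOn (fun x : ℝ => Γ x) b.halfLine) (s : Species) (β : ℝ) :
    Continuous (kernel Γ b s β) := by
  obtain ⟨B, hB⟩ := exists_norm_kernelIntegrand_le s
  refine continuous_of_dominated (fun t => aestronglyMeasurable_kernelIntegrand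
    hΓ.aestronglyMeasurable s β t) (fun t => Eventually.of_forall fun x => hB Γ β t x)
    (hΓ.norm.const_mul B) (Eventually.of_forall fun x => ?_)
  unfold kernelIntegrand
  fun_prop

theorem nodal_ofReal_ne_zero {Z : Finset ℂ} (hZ : ∀ a ∈ Z, 0 < a.im) (m : ℕ) (x : ℝ) :
    nodal Z m x ≠ 0 :=
  Finset.prod_ne_zero_iff.2 fun a ha => pow_ne_zero _ fun h => (hZ a ha).ne' <| by
    rw [← sub_eq_zero.1 h, ofReal_im]

theorem kernel_pos_eq {Γ : ℂ → ℂ} (hΓ : MeromorphicOn Γ {ω | 0 < ω.im}) {Z : Finset ℂ}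
    (hZ : ∀ a ∈ Z, 0 < a.im) (m : ℕ) (s : Species) (β t : ℝ) :
    kernel Γ .pos s β t = 1 / (2 * Real.pi) * ∫ x : ℝ in Set.Ioi 0,
      clearPoles Z m Γ x * s.occupation β x / nodal Z m x * exp (I * x * t) := by
  rw [kernel, ← integral_const_mul]
  refine setIntegral_congr_fun measurableSet_Ioi fun x _ => ?_
  have hnodal := nodal_ofReal_ne_zero hZ m x
  simp only [kernelIntegrand, clearPoles_ofReal hΓ]
  field_simp

namespace IsAdmissible

variable {Γ : ℂ → ℂ} {rmax : ℝ}

theorem integrableOn_Ioi (h₀ : 0 < rmax) (hrmax : 2 * rmax < Real.pi / 2)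
    (hΓ : IsAdmissible Γ .pos rmax) : IntegrableOn (fun x : ℝ => Γ x) (Set.Ioi 0) := by
  have hpi : 2 * rmax ≤ Real.pi := by linarith [Real.pi_pos]
  obtain ⟨Z, m, hZ, hord⟩ := hΓ.exists_order_nodal_mul_nonneg fun z => im_pos_of_mem_sector_pos hpi
  obtain ⟨C, κ, -, hκ, hdecays⟩ :=
    hΓ.exists_decaysInSector_clearPoles hrmax hord (α := rmax) ⟨h₀, by linarith⟩
  have hnodal := exists_le_norm_nodal_exp Z m (θ := 0) ⟨le_rfl, Real.pi_pos⟩ fun a ha =>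
    ⟨⟨(hZ a ha).1, (hZ a ha).2.trans_le hpi⟩, (hZ a ha).1.ne'⟩
  simp only [ofReal_zero, zero_mul, add_zero] at hnodal
  rw [← Real.range_exp, ← Set.image_univ, integrableOn_image_iff_integrableOn_abs_deriv_smul
    MeasurableSet.univ (fun x _ => (Real.hasDerivAt_exp x).hasDerivWithinAt)
    Real.exp_injective.injOn, integrableOn_univ]
  refine (hdecays.integrable_div_nodal h₀ (by linarith) hκ hnodal 1).congr
    (Eventually.of_forall fun x => ?_)
  have hne : nodal Z m (Real.exp x) ≠ 0 :=
    nodal_ofReal_ne_zero (fun a ha => im_pos_of_mem_sector_pos hpi (hZ a ha)) m _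
  simp only [← ofReal_exp, clearPoles_ofReal hΓ.meromorphic, Polynomial.eval_one, mul_one,
    abs_of_pos (Real.exp_pos x), real_smul]
  rw [mul_div_cancel_left₀ _ hne, mul_comm]

theorem exists_hasExpQuadrature_kernel (hrmax : 2 * rmax < Real.pi / 2)
    (hΓ : IsAdmissible Γ .pos rmax) {d : ℝ} (hd : d ∈ Set.Ioo 0 rmax) :
    ∃ K κ M, 0 ≤ K ∧ 0 < κ ∧ ∀ s β, HasExpQuadrature (kernel Γ .pos s β) d κ K M := by
  have hpi : 2 * rmax ≤ Real.pi := by linarith [Real.pi_pos]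
  obtain ⟨Z, m, hZ, hord⟩ := hΓ.exists_order_nodal_mul_nonneg fun z => im_pos_of_mem_sector_pos hpi
  obtain ⟨θ, hθ, hθZ⟩ := exists_mem_Ioo_forall_arg_ne Z
    (show 0 < 2 * (rmax - d) by linarith [hd.2]) d
  have hα : θ + 2 * d ∈ Set.Ioo 0 (2 * rmax) :=
    ⟨by linarith [hθ.1, hd.1], by linarith [hθ.2]⟩
  obtain ⟨C, κ, hC, hκ, hdecays⟩ := hΓ.exists_decaysInSector_clearPoles hrmax hord hα
  obtain ⟨B, hB, hocc⟩ := exists_decaysInSector_mul_occupation ⟨hα.1, hα.2.trans hrmax⟩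
  obtain ⟨K, M, hK, hquad⟩ := exists_hasExpQuadrature Z m hθ.1 hd.1 (hα.2.trans_le hpi) hκ
    (mul_nonneg hC hB.le) fun a ha => ⟨⟨(hZ a ha).1, (hZ a ha).2.trans_le hpi⟩, hθZ a ha⟩
  refine ⟨_, κ / 4, M, mul_nonneg (norm_nonneg (1 / (2 * Real.pi) : ℂ)) hK, by positivity,
    fun s β => ?_⟩
  rw [funext fun t => kernel_pos_eq hΓ.meromorphic
    (fun a ha => im_pos_of_mem_sector_pos hpi (hZ a ha)) m s β t]
  exact (hquad _ (hocc _ C κ hdecays s β)).const_mul _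

end IsAdmissible

theorem IsExpSum.expApprox {Δ p : ℝ → ℂ} {T ε : ℝ} {N : ℕ} (hp : IsExpSum N p)
    (hΔ : Continuous Δ) (hε : ∫ t in (0 : ℝ)..T, ‖Δ t - p t‖ < ε) : ExpApprox Δ T ε N := by
  have hcont : Continuous fun t => Δ t - p t := hΔ.sub hp.continuous
  obtain ⟨g, ω, hω, hsum⟩ := hp
  exact ⟨g, ω, fun t => Δ t - p t, hω, fun t _ => by rw [← hsum t, add_sub_cancel],
    hcont.intervalIntegrable _ _, hε⟩

theorem IsExpSumLimit.expApprox {Δ g : ℝ → ℂ} {b : ℝ → ℝ} {T ε : ℝ} {N : ℕ}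
    (hg : IsExpSumLimit T N g) (hT : 0 < T) (hΔ : Continuous Δ)
    (hb : IntervalIntegrable b volume 0 T) (hΔb : ∀ t ∈ Set.Icc 0 T, ‖Δ t - g t‖ ≤ b t)
    (hε : ∫ t in (0 : ℝ)..T, b t < ε) : ExpApprox Δ T ε N := by
  set η := (ε - ∫ t in (0 : ℝ)..T, b t) / (2 * T) with hη
  obtain ⟨p, hp, hgp⟩ := hg η (div_pos (sub_pos.2 hε) (by positivity))
  refine hp.expApprox hΔ ?_
  calc ∫ t in (0 : ℝ)..T, ‖Δ t - p t‖
      ≤ ∫ t in (0 : ℝ)..T, (b t + η) :=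
        intervalIntegral.integral_mono_on hT.le
          ((hΔ.sub hp.continuous).norm.intervalIntegrable _ _) (hb.add intervalIntegrable_const)
          fun t ht => (norm_sub_le_norm_sub_add_norm_sub (Δ t) (g t) (p t)).trans
            (add_le_add (hΔb t ht) (hgp t ht))
    _ = (∫ t in (0 : ℝ)..T, b t) + (ε - ∫ t in (0 : ℝ)..T, b t) / 2 := by
        rw [intervalIntegral.integral_add hb intervalIntegrable_const,
          intervalIntegral.integral_const, sub_zero, smul_eq_mul, hη]
        field_simp
    _ < ε := by linarith

theorem intervalIntegrable_div_one_add {T : ℝ} (hT : 0 ≤ T) (ρ : ℝ) :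
    IntervalIntegrable (fun t : ℝ => ρ / (1 + t)) volume 0 T :=
  (ContinuousOn.div continuousOn_const (by fun_prop) fun t ht => by
    rw [Set.uIcc_of_le hT] at ht
    linarith [ht.1]).intervalIntegrable

theorem integral_div_one_add {T : ℝ} (hT : 0 ≤ T) (ρ : ℝ) :
    ∫ t in (0 : ℝ)..T, ρ / (1 + t) = ρ * Real.log (1 + T) := by
  simp_rw [div_eq_mul_inv]
  rw [intervalIntegral.integral_const_mul,
    intervalIntegral.integral_comp_add_left (fun y => y⁻¹),
    integral_inv_of_pos (by norm_num) (by linarith), add_zero, div_one]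

theorem IsExpSumLimit.expApprox_of_norm_sub_le {Δ g : ℝ → ℂ} {T ε K ρ x : ℝ} {N : ℕ}
    (hg : IsExpSumLimit T N g) (hT : 0 < T) (hΔ : Continuous Δ)
    (hΔg : ∀ t : ℝ, 0 ≤ t → ‖Δ t - g t‖ ≤ K * (ρ / (1 + t) + x))
    (hε : K * (ρ * Real.log (1 + T) + T * x) < ε) : ExpApprox Δ T ε N := by
  have hρ := intervalIntegrable_div_one_add hT.le ρ
  refine hg.expApprox hT hΔ ((hρ.add intervalIntegrable_const).const_mul K)
    (fun t ht => hΔg t ht.1) ?_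
  rwa [intervalIntegral.integral_const_mul, intervalIntegral.integral_add hρ
    intervalIntegrable_const, integral_div_one_add hT.le, intervalIntegral.integral_const,
    sub_zero, smul_eq_mul]

namespace HasExpQuadrature

variable {Δ : ℝ → ℂ} {d κ K : ℝ} {M : ℕ}

theorem exists_isExpSumLimit (hΔ : HasExpQuadrature Δ d κ K M) (hd : 0 < d) (hκ : 0 < κ)
    (hK : 0 ≤ K) {ℓ L : ℝ} (hℓ : 1 ≤ ℓ) (hℓd : 2 * Real.pi * d ≤ ℓ) (hL : 0 < L) :
    ∃ (N : ℕ) (g : ℝ → ℂ),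
      (N : ℝ) ≤ (L + max 0 (Real.log (L / κ))) * (ℓ / (2 * Real.pi * d)) + (M + 2) ∧
      (∀ T, IsExpSumLimit T N g) ∧ ∀ t : ℝ, 0 ≤ t →
        ‖Δ t - g t‖ ≤ K * (Real.exp (-ℓ) / (1 + t) + 2 * Real.exp (-L)) := by
  set h := 2 * Real.pi * d / ℓ with hh
  have hh₀ : 0 < h := by positivity
  have hhℓ : 2 * Real.pi * d / h = ℓ := by rw [hh]; field_simp
  set N₁ := ⌈L / h⌉₊
  set N₂ := ⌈max 0 (Real.log (L / κ)) / h⌉₊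
  obtain ⟨g, hg, hΔg⟩ := hΔ h hh₀ ((div_le_one (by linarith)).2 hℓd)
    (by rw [hhℓ]; linarith [Real.add_one_le_exp ℓ]) N₁ N₂
  refine ⟨N₁ + N₂ + M, g, ?_, hg, fun t ht => (hΔg t ht).trans ?_⟩
  · have hN₁ : (N₁ : ℝ) < L / h + 1 := Nat.ceil_lt_add_one (by positivity)
    have hN₂ : (N₂ : ℝ) < max 0 (Real.log (L / κ)) / h + 1 := Nat.ceil_lt_add_one (by positivity)
    have hinv : ℓ / (2 * Real.pi * d) = 1 / h := by rw [hh, one_div_div]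
    push_cast
    rw [hinv, mul_one_div, add_div]
    linarith
  · have hN₁ : L ≤ N₁ * h := (div_le_iff₀ hh₀).1 (Nat.le_ceil _)
    have hN₂ : L ≤ κ * Real.exp (N₂ * h) := by
      rw [mul_comm, ← div_le_iff₀ hκ, ← Real.log_le_iff_le_exp (by positivity)]
      exact (le_max_right _ _).trans ((div_le_iff₀ hh₀).1 (Nat.le_ceil _))
    rw [hhℓ, add_assoc, two_mul, neg_mul]
    gcongr

/-- The choice `ℓ = log (log (e + T) / ε)` of the discretization error and `L = log (T / ε)` of the
truncation errors makes each of their three contributions to the `L¹` error a multiple of `ε`;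
the shift by `log (3 * K + 2)` normalizes the multiple. -/
theorem exists_expApprox (hΔ : HasExpQuadrature Δ d κ K M) (hcont : Continuous Δ) (hd : 0 < d)
    (hκ : 0 < κ) (hK : 0 ≤ K) {T ε : ℝ} (hT : 0 < T) (hε : 0 < ε) (hL : 0 < Real.log (T / ε))
    (hℓ : 1 ≤ Real.log (Real.log (Real.exp 1 + T) / ε))
    (hℓd : 2 * Real.pi * d ≤ Real.log (Real.log (Real.exp 1 + T) / ε)) :
    ∃ N, ExpApprox Δ T ε N ∧
      (N : ℝ) ≤ (Real.log (T / ε) + Real.log (3 * K + 2) +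
          max 0 (Real.log ((Real.log (T / ε) + Real.log (3 * K + 2)) / κ))) *
        ((Real.log (Real.log (Real.exp 1 + T) / ε) + Real.log (3 * K + 2)) / (2 * Real.pi * d)) +
          (M + 2) := by
  have hc : 0 < Real.log (3 * K + 2) := Real.log_pos (by linarith)
  obtain ⟨N, g, hN, hg, hΔg⟩ := hΔ.exists_isExpSumLimit hd hκ hK
    (hℓ.trans (le_add_of_nonneg_right hc.le)) (hℓd.trans (le_add_of_nonneg_right hc.le))
    (add_pos hL hc)
  have hlogT : 0 < Real.log (Real.exp 1 + T) :=
    Real.log_pos (by linarith [Real.add_one_le_exp 1])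
  have hexp : ∀ {y : ℝ}, 0 < y →
      Real.exp (-(Real.log y + Real.log (3 * K + 2))) = 1 / (y * (3 * K + 2)) := fun hy => by
    rw [← Real.log_mul hy.ne' (by positivity), Real.exp_neg, Real.exp_log (by positivity), one_div]
  refine ⟨N, (hg T).expApprox_of_norm_sub_le hT hcont hΔg ?_, hN⟩
  have hmono : Real.log (1 + T) ≤ Real.log (Real.exp 1 + T) :=
    Real.log_le_log (by linarith) (by linarith [Real.add_one_le_exp 1])
  rw [hexp (by positivity), hexp (by positivity)]
  calc K * (1 / (Real.log (Real.exp 1 + T) / ε * (3 * K + 2)) * Real.log (1 + T) +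
        T * (2 * (1 / (T / ε * (3 * K + 2)))))
      ≤ K * (1 / (Real.log (Real.exp 1 + T) / ε * (3 * K + 2)) * Real.log (Real.exp 1 + T) +
        T * (2 * (1 / (T / ε * (3 * K + 2))))) := by gcongr
    _ = 3 * K / (3 * K + 2) * ε := by field_simp; ring
    _ < ε := mul_lt_of_lt_one_left hε ((div_lt_one (by positivity)).2 (by linarith))

end HasExpQuadrature

theorem eventually_max_log_div_le {σ κ : ℝ} (hσ : 0 < σ) (hκ : 0 < κ) (c : ℝ) :
    ∀ᶠ L : ℝ in atTop, max 0 (Real.log ((L + c) / κ)) ≤ σ * L := by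
  have htop : Tendsto (fun L : ℝ => (L + c) / κ) atTop atTop :=
    (tendsto_atTop_add_const_right _ c tendsto_id).atTop_div_const hκ
  have hbigO : (fun L : ℝ => (L + c) / κ) =O[atTop] (id : ℝ → ℝ) := by
    simp_rw [div_eq_inv_mul]
    exact ((Asymptotics.isBigO_refl id atTop).add
      (Asymptotics.isLittleO_const_id_atTop c).isBigO).const_mul_left _
  have hlittleO := (Real.isLittleO_log_id_atTop.comp_tendsto htop).trans_isBigO hbigO
  filter_upwards [hlittleO.bound hσ, eventually_ge_atTop 0] with L hL hL₀
  rw [id, Real.norm_of_nonneg hL₀] at hL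
  exact max_le (by positivity) ((le_abs_self _).trans hL)

theorem exists_pos_one_add_sq_add_le {q : ℝ} (hq : 1 < q) : ∃ σ, 0 < σ ∧ (1 + σ) ^ 2 + σ ≤ q := by
  have hσ₁ : min 1 ((q - 1) / 4) ≤ 1 := min_le_left _ _
  have hσ₂ : min 1 ((q - 1) / 4) ≤ (q - 1) / 4 := min_le_right _ _
  have hσ : 0 < min 1 ((q - 1) / 4) := lt_min one_pos (by linarith)
  exact ⟨_, hσ, by nlinarith⟩

/-- The lower-order terms in the number of exponentials are absorbed by increasing
`1 / d` to `1 / r`. -/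
theorem exists_count_le {r d κ : ℝ} (hr : 0 < r) (hrd : r < d) (hκ : 0 < κ) (c : ℝ) (M : ℕ) :
    ∃ σ, 0 < σ ∧ ∀ᶠ L : ℝ in atTop, ∀ ℓ lam : ℝ, 1 ≤ lam → 0 ≤ ℓ + c →
      ℓ + c ≤ (1 + σ) * lam →
      (L + c + max 0 (Real.log ((L + c) / κ))) * ((ℓ + c) / (2 * Real.pi * d)) + (M + 2) ≤
        1 / (2 * Real.pi * r) * lam * L := by
  have hd : 0 < d := hr.trans hrd
  obtain ⟨σ, hσ, hσq⟩ := exists_pos_one_add_sq_add_le ((one_lt_div hr).2 hrd)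
  refine ⟨σ, hσ, ?_⟩
  filter_upwards [eventually_max_log_div_le (half_pos hσ) hκ c, eventually_gt_atTop 0,
    eventually_ge_atTop (2 * c / σ), eventually_ge_atTop ((M + 2) * (2 * Real.pi * d) / σ)]
    with L hlog hL hc hM ℓ lam hlam hℓ₀ hℓ
  rw [div_le_iff₀ hσ] at hc hM
  have hnodes : L + c + max 0 (Real.log ((L + c) / κ)) ≤ (1 + σ) * L := by linarith
  have hpoles : (M + 2) * (2 * Real.pi * d) ≤ σ * (lam * L) := by
    nlinarith [mul_le_mul_of_nonneg_left hlam (mul_pos hσ hL).le]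
  rw [← mul_div_assoc, div_add' _ _ _ (by positivity), div_le_iff₀ (by positivity)]
  calc (L + c + max 0 (Real.log ((L + c) / κ))) * (ℓ + c) + (M + 2) * (2 * Real.pi * d)
      ≤ (1 + σ) * L * ((1 + σ) * lam) + σ * (lam * L) := by gcongr
    _ = ((1 + σ) ^ 2 + σ) * (lam * L) := by ring
    _ ≤ d / r * (lam * L) := by gcongr
    _ = 1 / (2 * Real.pi * r) * lam * L * (2 * Real.pi * d) := by field_simp

theorem log_exp_one_add_le {T X : ℝ} (hT : 0 < T) (hX : 1 ≤ X) (h : Real.log T ≤ X) :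
    Real.log (Real.exp 1 + T) ≤ 3 * X := by
  rw [Real.log_le_iff_le_exp (by positivity)]
  have hTX : T ≤ Real.exp X := (Real.log_le_iff_le_exp hT).1 h
  have heX : Real.exp 1 ≤ Real.exp X := Real.exp_le_exp.2 hX
  have hX₂ : 2 ≤ Real.exp (2 * X) := by linarith [Real.add_one_le_exp (2 * X)]
  calc Real.exp 1 + T ≤ 2 * Real.exp X := by linarith
    _ ≤ Real.exp (2 * X) * Real.exp X := by gcongr
    _ = Real.exp (3 * X) := by rw [← Real.exp_add]; ring_nf

theorem log_log_exp_one_add_div_le {T ε a : ℝ} (hT : 0 < T) (hε : 0 < ε) (hε₁ : ε ≤ 1)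
    (ha : 0 ≤ a) (h : Real.log T ≤ (1 / ε) ^ a) :
    Real.log (Real.log (Real.exp 1 + T) / ε) ≤ Real.log 3 + (1 + a) * Real.log (1 / ε) := by
  have hlog : 0 < Real.log (Real.exp 1 + T) :=
    Real.log_pos (by linarith [Real.add_one_le_exp 1])
  have hpow : Real.log (Real.exp 1 + T) ≤ 3 * (1 / ε) ^ a :=
    log_exp_one_add_le hT (Real.one_le_rpow (by rwa [one_le_div hε]) ha) h
  calc Real.log (Real.log (Real.exp 1 + T) / ε)
      ≤ Real.log (3 * (1 / ε) ^ a * (1 / ε)) :=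
        Real.log_le_log (by positivity) (by rw [mul_one_div]; gcongr)
    _ = Real.log 3 + (1 + a) * Real.log (1 / ε) := by
        rw [Real.log_mul (by positivity) (by positivity), Real.log_mul (by norm_num)
          (by positivity), Real.log_rpow (by positivity)]
        ring

theorem le_log_div {a ε T₀ T : ℝ} (hT₀ : 0 < T₀) (hε : 0 < ε) (hεT₀ : ε ≤ T₀ * Real.exp (-a))
    (hT : T₀ ≤ T) : a ≤ Real.log (T / ε) := by
  have hTpos : 0 < T := hT₀.trans_le hT
  rw [Real.exp_neg, ← div_eq_mul_inv, le_div_iff₀ (Real.exp_pos a)] at hεT₀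
  rw [Real.le_log_iff_exp_le (by positivity), le_div_iff₀ hε, mul_comm]
  exact hεT₀.trans hT

/-- Approximation of `Δ` on `[0, T]` up to `ε` by exponentials whose number is a product of two
logarithms. The exponent `c` delimits the range of times in which the first logarithm is
`log (1 / ε)`. -/
def HasLogExpApprox (Δ : ℝ → ℂ) (r c ε T : ℝ) : Prop :=
  (∃ N : ℕ, ExpApprox Δ T ε N ∧ (N : ℝ) ≤ 1 / (2 * Real.pi * r) *
    Real.log (Real.log (Real.exp 1 + T) / ε) * Real.log (T / ε)) ∧
  (Real.log T ≤ (1 / ε) ^ c → ∃ N : ℕ, ExpApprox Δ T ε N ∧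
    (N : ℝ) ≤ 1 / (2 * Real.pi * r) * Real.log (1 / ε) * Real.log (T / ε))

theorem exists_forall_hasLogExpApprox {r d κ K T₀ : ℝ} (hr : 0 < r) (hrd : r < d) (hκ : 0 < κ)
    (hK : 0 ≤ K) (M : ℕ) (hT₀ : 0 < T₀) :
    ∃ ε₀ c : ℝ, 0 < ε₀ ∧ 0 < c ∧ ∀ Δ, Continuous Δ → HasExpQuadrature Δ d κ K M →
      ∀ ε T : ℝ, 0 < ε → ε < ε₀ → T₀ ≤ T → HasLogExpApprox Δ r c ε T := by
  have hd : 0 < d := hr.trans hrd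
  have hc : 0 < Real.log (3 * K + 2) := Real.log_pos (by linarith)
  have hlog₃ : 0 < Real.log 3 := Real.log_pos (by norm_num)
  obtain ⟨σ, hσ, hcount⟩ := exists_count_le hr hrd hκ (Real.log (3 * K + 2)) M
  obtain ⟨L₀, hL₀⟩ := eventually_atTop.1 (hcount.and (eventually_gt_atTop 0))
  set Y := 1 + 2 * Real.pi * d + (Real.log 3 + Real.log (3 * K + 2)) / (σ / 2) with hY
  refine ⟨min (T₀ * Real.exp (-L₀)) (1 * Real.exp (-Y)), σ / 2, by positivity, half_pos hσ,
    fun Δ hcont hΔ ε T hε hε₀ hT => ?_⟩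
  have hTpos : 0 < T := hT₀.trans_le hT
  obtain ⟨hN, hL⟩ := hL₀ _ (le_log_div hT₀ hε (hε₀.le.trans (min_le_left _ _)) hT)
  have hlam : Y ≤ Real.log (1 / ε) :=
    le_log_div one_pos hε (hε₀.le.trans (min_le_right _ _)) le_rfl
  have hℓ : Real.log (1 / ε) ≤ Real.log (Real.log (Real.exp 1 + T) / ε) := by
    have : 1 ≤ Real.log (Real.exp 1 + T) :=
      (Real.le_log_iff_exp_le (by positivity)).2 (by linarith)
    gcongr
  have hYd : 0 < 2 * Real.pi * d := by positivity
  have hYσ : 0 < (Real.log 3 + Real.log (3 * K + 2)) / (σ / 2) := by positivity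
  have hlamσ : Real.log 3 + Real.log (3 * K + 2) ≤ σ / 2 * Real.log (1 / ε) := by
    rw [← div_le_iff₀' (half_pos hσ)]
    linarith
  obtain ⟨N, hΔN, hNle⟩ := hΔ.exists_expApprox hcont hd hκ hK hTpos hε hL (by linarith)
    (by linarith)
  refine ⟨⟨N, hΔN, hNle.trans (hN _ _ (by linarith) (by linarith) ?_)⟩, fun hTε =>
    ⟨N, hΔN, hNle.trans (hN _ _ (by linarith) (by linarith) ?_)⟩⟩
  · nlinarith
  · have hε₁ : ε ≤ 1 := by
      refine le_of_not_gt fun h => ?_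
      have := Real.log_neg (by positivity) ((div_lt_one hε).2 h)
      linarith
    linarith [log_log_exp_one_add_div_le hTpos hε hε₁ (half_pos hσ).le hTε]

theorem IsAdmissible.exists_forall_hasLogExpApprox_pos {Γ : ℂ → ℂ} {rmax r T₀ : ℝ}
    (hrmax : 2 * rmax < Real.pi / 2) (hΓ : IsAdmissible Γ .pos rmax) (hr : r ∈ Set.Ioo 0 rmax)
    (hT₀ : 0 < T₀) (s : Species) :
    ∃ ε₀ c : ℝ, 0 < ε₀ ∧ 0 < c ∧ ∀ β ε T : ℝ, 0 < ε → ε < ε₀ → T₀ ≤ T →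
      HasLogExpApprox (kernel Γ .pos s β) r c ε T := by
  obtain ⟨d, hrd, hd⟩ := exists_between hr.2
  obtain ⟨K, κ, M, hK, hκ, hquad⟩ :=
    hΓ.exists_hasExpQuadrature_kernel hrmax ⟨hr.1.trans hrd, hd⟩
  obtain ⟨ε₀, c, hε₀, hc, happrox⟩ := exists_forall_hasLogExpApprox hr.1 hrd hκ hK M hT₀
  exact ⟨ε₀, c, hε₀, hc, fun β => happrox _
    (continuous_kernel (hΓ.integrableOn_Ioi (hr.1.trans hr.2) hrmax) s β) (hquad s β)⟩

theorem ExpApprox.conj {Δ : ℝ → ℂ} {T ε : ℝ} {N : ℕ} (h : ExpApprox Δ T ε N) :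
    ExpApprox (fun t => conj (Δ t)) T ε N := by
  obtain ⟨g, ω, δ, hω, hsum, hint, hlt⟩ := h
  refine ⟨fun k => conj (g k), fun k => -conj (ω k), fun t => conj (δ t),
    fun k => by simpa using hω k, fun t ht => ?_, ?_, ?_⟩
  · simp [hsum t ht, ← exp_conj]
  · rw [intervalIntegrable_iff] at hint ⊢
    exact conjCLE.toContinuousLinearMap.integrable_comp hint
  · simpa using hlt

theorem HasLogExpApprox.conj {Δ : ℝ → ℂ} {r c ε T : ℝ} (h : HasLogExpApprox Δ r c ε T) :
    HasLogExpApprox (fun t => conj (Δ t)) r c ε T :=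
  ⟨h.1.imp fun _ hN => ⟨hN.1.conj, hN.2⟩, fun hT => (h.2 hT).imp fun _ hN => ⟨hN.1.conj, hN.2⟩⟩

/-- The Schwarz reflection of `f` in the imaginary axis. It exchanges positive and negative
frequencies. -/
noncomputable def reflectIm (f : ℂ → ℂ) (z : ℂ) : ℂ := conj (f (-conj z))

theorem continuous_neg_conj : Continuous fun z : ℂ => -conj z := continuous_conj.neg

theorem neg_conj_injective : Function.Injective fun z : ℂ => -conj z :=
  neg_injective.comp (starRingEnd ℂ).injective

theorem map_neg_conj_nhdsNE (z : ℂ) : map (fun w : ℂ => -conj w) (𝓝[≠] z) = 𝓝[≠] (-conj z) :=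
  (conjCLE.toHomeomorph.trans (Homeomorph.neg ℂ)).map_punctured_nhds_eq z

theorem norm_reflectIm (f : ℂ → ℂ) (z : ℂ) : ‖reflectIm f z‖ = ‖f (-conj z)‖ := norm_conj _

theorem analyticAt_reflectIm {f : ℂ → ℂ} {z : ℂ} (hf : AnalyticAt ℂ f (-conj z)) :
    AnalyticAt ℂ (reflectIm f) z := by
  rw [analyticAt_iff_eventually_differentiableAt] at hf ⊢
  filter_upwards [continuous_neg_conj.continuousAt.eventually hf] with w hw
  have hneg : DifferentiableAt ℂ (fun v => f (-v)) (conj w) :=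
    DifferentiableAt.comp (g := f) (conj w) hw differentiable_neg.differentiableAt
  have hconj := hneg.conj_conj
  rw [conj_conj] at hconj
  exact hconj

theorem meromorphicAt_reflectIm {f : ℂ → ℂ} {z : ℂ} (hf : MeromorphicAt f (-conj z)) :
    MeromorphicAt (reflectIm f) z := by
  obtain ⟨n, hn⟩ := hf
  refine ⟨n, ((analyticAt_const (v := (-1 : ℂ) ^ n)).mul (analyticAt_reflectIm hn)).congr
    (Eventually.of_forall fun w => ?_)⟩
  simp only [reflectIm, Pi.mul_apply, smul_eq_mul, map_mul, map_pow, map_sub, map_neg, conj_conj]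
  rw [← mul_assoc, ← mul_pow]
  ring

theorem meromorphicOrderAt_reflectIm_neg_iff {f : ℂ → ℂ} {z : ℂ}
    (hf : MeromorphicAt f (-conj z)) :
    meromorphicOrderAt (reflectIm f) z < 0 ↔ meromorphicOrderAt f (-conj z) < 0 := by
  rw [← tendsto_cobounded_iff_meromorphicOrderAt_neg hf,
    ← tendsto_cobounded_iff_meromorphicOrderAt_neg (meromorphicAt_reflectIm hf),
    ← tendsto_norm_atTop_iff_cobounded, ← tendsto_norm_atTop_iff_cobounded,
    ← map_neg_conj_nhdsNE, tendsto_map'_iff]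
  simp only [norm_reflectIm, Function.comp_def]

theorem neg_conj_mem_sector_neg {α : ℝ} (hα : α ≤ Real.pi) {z : ℂ}
    (hz : z ∈ FreqSign.pos.sector α) : -conj z ∈ FreqSign.neg.sector α := by
  have him : (conj z).im < 0 := by simpa using im_pos_of_mem_sector_pos hα hz
  have harg : (-conj z).arg = Real.pi - z.arg := by
    rw [arg_neg_eq_arg_add_pi_of_im_neg him, arg_conj, if_neg (hz.2.trans_le hα).ne]
    ring
  change Real.pi - α < (-conj z).arg ∧ (-conj z).arg < Real.pi
  rw [harg]
  exact ⟨sub_lt_sub_left hz.2 _, sub_lt_self _ hz.1⟩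

theorem kernelIntegrand_neg (Γ : ℂ → ℂ) (s : Species) (β t x : ℝ) :
    kernelIntegrand Γ s β t ((-x : ℝ) : ℂ) =
      conj (kernelIntegrand (reflectIm Γ) s (-β) t (x : ℂ)) := by
  have hfermi : fermi β ((-x : ℝ) : ℂ) = conj (fermi (-β) (x : ℂ)) := by simp [fermi, ← exp_conj]
  have hocc : s.occupation β ((-x : ℝ) : ℂ) = conj (s.occupation (-β) (x : ℂ)) := by
    cases s <;> simp only [Species.occupation, hfermi, map_sub, map_one]
  rw [kernelIntegrand, kernelIntegrand, hocc]
  simp [reflectIm, ← exp_conj, map_ofNat (starRingEnd ℂ) 2]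

theorem kernel_neg_eq_conj (Γ : ℂ → ℂ) (s : Species) (β t : ℝ) :
    kernel Γ .neg s β t = conj (kernel (reflectIm Γ) .pos s (-β) t) := by
  have hneg := integral_comp_neg_Ioi 0 fun x : ℝ => kernelIntegrand Γ s β t (x : ℂ)
  rw [neg_zero, integral_Iic_eq_integral_Iio] at hneg
  simp only [kernel, FreqSign.halfLine, ← hneg, kernelIntegrand_neg, integral_conj]

namespace IsAdmissible

variable {Γ : ℂ → ℂ} {b : FreqSign} {rmax : ℝ}

protected theorem reflectIm (hrmax : 2 * rmax ≤ Real.pi) (hΓ : IsAdmissible Γ .neg rmax) :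
    IsAdmissible (reflectIm Γ) .pos rmax where
  meromorphic z hz := meromorphicAt_reflectIm (hΓ.meromorphic (-conj z) (by simpa using hz))
  decay := by
    obtain ⟨G, ν, R, hν, h⟩ := hΓ.decay
    refine ⟨G, ν, R, hν, fun z hz hR => ?_⟩
    simpa [norm_reflectIm] using h _ (neg_conj_mem_sector_neg hrmax hz) (by simpa using hR)
  finite_poles := by
    refine (hΓ.finite_poles.preimage neg_conj_injective.injOn).subset fun z hz =>
      ⟨neg_conj_mem_sector_neg hrmax hz.1, ?_⟩
    have him : 0 < (-conj z).im := by simpa using im_pos_of_mem_sector_pos hrmax hz.1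
    exact (meromorphicOrderAt_reflectIm_neg_iff (hΓ.meromorphic _ him)).1 hz.2
  boundary x hx := by
    have hΓx := hΓ.boundary (-x) (neg_neg_of_pos (Set.mem_Ioi.1 hx) :)
    rw [show ((-x : ℝ) : ℂ) = -conj (x : ℂ) by simp] at hΓx
    exact continuous_conj.continuousAt.comp_continuousWithinAt <|
      ContinuousWithinAt.comp (f := fun w : ℂ => -conj w) hΓx
        continuous_neg_conj.continuousWithinAt fun w hw => by simpa using hw
  bounded_zero := by
    obtain ⟨C, δ, hδ, h⟩ := hΓ.bounded_zero
    refine ⟨C, δ, hδ, fun z hz hzδ => ?_⟩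
    simpa [norm_reflectIm] using h _ (neg_conj_mem_sector_neg hrmax hz) (by simpa using hzδ)

theorem integrableOn_halfLine (h₀ : 0 < rmax) (hrmax : 2 * rmax < Real.pi / 2)
    (hΓ : IsAdmissible Γ b rmax) : IntegrableOn (fun x : ℝ => Γ x) b.halfLine := by
  cases b with
  | pos => exact hΓ.integrableOn_Ioi h₀ hrmax
  | neg =>
    have hint := ((hΓ.reflectIm (by linarith)).integrableOn_Ioi h₀ hrmax).comp_neg
    rw [Set.neg_Ioi, neg_zero] at hint
    simpa [reflectIm, IntegrableOn, FreqSign.halfLine] using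
      conjCLE.toContinuousLinearMap.integrable_comp hint

theorem exists_forall_hasLogExpApprox {r T₀ : ℝ} (hrmax : 2 * rmax < Real.pi / 2)
    (hΓ : IsAdmissible Γ b rmax) (hr : r ∈ Set.Ioo 0 rmax) (hT₀ : 0 < T₀) (s : Species) :
    ∃ ε₀ c : ℝ, 0 < ε₀ ∧ 0 < c ∧ ∀ β ε T : ℝ, 0 < ε → ε < ε₀ → T₀ ≤ T →
      HasLogExpApprox (kernel Γ b s β) r c ε T := by
  cases b with
  | pos => exact hΓ.exists_forall_hasLogExpApprox_pos hrmax hr hT₀ s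
  | neg =>
    obtain ⟨ε₀, c, hε₀, hc, h⟩ :=
      (hΓ.reflectIm (by linarith [Real.pi_pos])).exists_forall_hasLogExpApprox_pos hrmax hr hT₀ s
    refine ⟨ε₀, c, hε₀, hc, fun β ε T hε hεε₀ hT => ?_⟩
    rw [funext (kernel_neg_eq_conj Γ s β)]
    exact (h (-β) ε T hε hεε₀ hT).conj

end IsAdmissible

theorem theorem1 (rmax : ℝ) (hrmax : 0 < rmax) (hrmax' : rmax < Real.pi / 4)
    (Γ : ℂ → ℂ) (b : FreqSign) (hΓ : IsAdmissible Γ b rmax) (s : Species) :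
    (∀ β t : ℝ, 0 ≤ t →
      MeasureTheory.IntegrableOn (fun ω : ℝ => kernelIntegrand Γ s β t (ω : ℂ)) b.halfLine) ∧
    ∀ r : ℝ, 0 < r → r < rmax → ∀ T₀ : ℝ, 0 < T₀ →
      ∃ ε₀ c : ℝ, 0 < ε₀ ∧ 0 < c ∧
        ∀ β ε T : ℝ, 0 < ε → ε < ε₀ → T₀ ≤ T →
          (∃ N : ℕ, ExpApprox (kernel Γ b s β) T ε N ∧
            (N : ℝ) ≤ 1 / (2 * Real.pi * r) *
              Real.log (Real.log (Real.exp 1 + T) / ε) * Real.log (T / ε)) ∧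
          (Real.log T ≤ (1 / ε) ^ c →
            ∃ N : ℕ, ExpApprox (kernel Γ b s β) T ε N ∧
              (N : ℝ) ≤ 1 / (2 * Real.pi * r) * Real.log (1 / ε) * Real.log (T / ε)) := by
  have hrmax₂ : 2 * rmax < Real.pi / 2 := by linarith
  exact ⟨fun β t _ => integrable_kernelIntegrand (hΓ.integrableOn_halfLine hrmax hrmax₂) s β t,
    fun r hr hr' T₀ hT₀ => hΓ.exists_forall_hasLogExpApprox hrmax₂ ⟨hr, hr'⟩ hT₀ s⟩
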